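/- Let $d=3$. Write $|\Omega_n\rangle=n^{-1/2}\sum_{j=1}^n|j,j\rangle$, and for a linear map $S:\mathcal M_n\to\mathcal M_n$ let $\rho_S=(\mathrm{id}\otimes S)(|\Omega_n\rangle\langle\Omega_n|)$ be its Jamiolkowski operator. Call $S$ a *mixture of unitaries* if $S(\rho)=\sum_{i=1}^N p_iU_i\rho U_i^\dagger$ for some $N$, unitary $U_i\in\mathcal M_n$ and $p_i>0$ with $\sum_ip_i=1$. Let $\mathbb F|k,l\rangle=|l,k\rangle$ on $\mathbb C^3\otimes\mathbb C^3$, and let $\rho_-=(\mathbb 1-\mathbb F)/6$ and $\rho_+=(\mathbb 1+\mathbb F)/12$ be the normalized projections onto the antisymmetric and the symmetric subspace. For $-\tfrac43\le\epsilon\le\tfrac23=\tfrac2d$ let $$T_\epsilon:\mathcal M_3\to\mathcal M_3,\qquad T_\epsilon(\rho)=\frac{1+\delta}{3}\,\mathrm{tr}[\rho]\,\mathbb 1-\delta\,\rho^T,\qquad \delta=\frac14+\frac{3\epsilon}{8}.$$ For linear maps $S$ on $\mathcal M_9=\mathcal M_3\otimes\mathcal M_3$ put $$\big(\langle F\rangle,\langle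 F_{12}\rangle\big)_S=\big(\mathrm{tr}[\rho_SF],\mathrm{tr}[\rho_SF_{12}]\big),\qquad F=\tfrac12(\mathbb F^{(1)}+\mathbb F^{(2)}),\quad F_{12}=\mathbb F^{(1)}\mathbb F^{(2)},$$ where $\mathbb F^{(k)}$ exchanges the $k$-th tensor factor $\mathbb C^3$ of the input with the $k$-th tensor factor of the output. Finally let $$\epsilon^*=\tfrac23\big(4-3\sqrt2-\sqrt3+\sqrt6\big).$$ Then: 1. For all $\epsilon\in[-\frac43,\frac23]$ the map $T_\epsilon$ is a unital quantum channel (completely positive, trace preserving, $T_\epsilon(\mathbb 1)=\mathbb 1$), $\rho_{T_\epsilon}=(1-\frac13+\frac\epsilon2)\rho_-+(\frac13-\frac\epsilon2)\rho_+$ and $\mathrm{tr}[\rho_{T_\epsilon}\mathbb F]=-1+\frac23-\epsilon$. 2. For all $\epsilon\in(0,\frac23]$ the channel $T_\epsilon$ is not a mixture of unitaries. 3. For $\vartheta\in[0,\pi/2]$ let $D(\vartheta)=R\oplus R\oplus R\oplus R\oplus 1$ with $R=\begin{pmatrix}\cos\vartheta&-\sin\vartheta\\\sin\vartheta&\cos\vartheta\end{pmatrix}$,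 let $$V=\begin{pmatrix} 0&\frac{i}{\sqrt2}&-\frac{i}{2\sqrt6}&0&-\frac{i}{2\sqrt2}&0&0&0&\frac1{\sqrt3}\\ \frac{i}{\sqrt2}&0&-\sqrt{\frac38}&0&\frac1{2\sqrt2}&0&0&0&0\\ 0&0&0&0&0&\frac1{\sqrt2}&0&\frac{i}{\sqrt2}&0\\ \frac{i}{\sqrt2}&0&\sqrt{\frac38}&0&-\frac1{2\sqrt2}&0&0&0&0\\ 0&0&\frac{i}{\sqrt6}&0&\frac{i}{\sqrt2}&0&0&0&\frac1{\sqrt3}\\ 0&0&0&\frac1{\sqrt2}&0&0&\frac{i}{\sqrt2}&0&0\\ 0&0&0&0&0&-\frac1{\sqrt2}&0&\frac{i}{\sqrt2}&0\\ 0&0&0&-\frac1{\sqrt2}&0&0&\frac{i}{\sqrt2}&0&0\\ 0&-\frac{i}{\sqrt2}&-\frac{i}{2\sqrt6}&0&-\frac{i}{2\sqrt2}&0&0&0&\frac1{\sqrt3} \end{pmatrix}$$ with respect to the basis $|11\rangle,|12\rangle,\dots,|33\rangle$, and let $U(\vartheta)=VD(\vartheta)V^T$. Then $U(\vartheta)$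 is unitary, and the channel $\rho\mapsto U(\vartheta)\rho\,U(\vartheta)^\dagger$ on $\mathcal M_9$ has the coordinates $$\big(\langle F\rangle,\langle F_{12}\rangle\big)=\tfrac19\Big(-\tfrac83(\cos\vartheta+1)^2+3,\;16\cos^2\vartheta-7\Big).$$ 4. For all $\epsilon\in[-\frac43,\frac23]$ the map $T_\epsilon\otimes T_\epsilon$ has the coordinates $(x,x^2)$ with $x=-1+\frac23-\epsilon$. For $\epsilon=\epsilon^*$ they coincide with the coordinates in 3 for some $\vartheta\in[0,\pi/2]$. 5. For all $\epsilon\in[-\frac43,\epsilon^*]$ the channel $T_\epsilon\otimes T_\epsilon$ is a mixture of unitaries. Here $\epsilon^*\approx1/\sqrt{10}$, in the sense that $|\epsilon^*-1/\sqrt{10}|<10^{-3}$. In particular, for $0<\epsilon\le\epsilon^*$ the channel $T_\epsilon$ is not a mixture of unitaries while $T_\epsilon\otimes T_\epsilon$ is one. -/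

import Mathlib

open scoped Kronecker ComplexOrder

noncomputable section

namespace TwoCopies

/-! ### Channels on matrix algebras -/

section Channels

variable {m n : Type*} [Fintype m] [DecidableEq m] [Fintype n] [DecidableEq n]

/-- The tensor product `S ⊗ T` of two linear maps on matrix algebras, acting on matrices indexed by
pairs; it is characterised by `tensorMap_kronecker`. -/
def tensorMap (S : Matrix m m ℂ →ₗ[ℂ] Matrix m m ℂ) (T : Matrix n n ℂ →ₗ[ℂ] Matrix n n ℂ) :
    Matrix (m × n) (m × n) ℂ →ₗ[ℂ] Matrix (m × n) (m × n) ℂ :=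
  (kroneckerLinearEquiv m m n n ℂ).toLinearMap ∘ₗ
    TensorProduct.map S T ∘ₗ (kroneckerLinearEquiv m m n n ℂ).symm.toLinearMap

theorem tensorMap_kronecker (S : Matrix m m ℂ →ₗ[ℂ] Matrix m m ℂ)
    (T : Matrix n n ℂ →ₗ[ℂ] Matrix n n ℂ) (A : Matrix m m ℂ) (B : Matrix n n ℂ) :
    tensorMap S T (A ⊗ₖ B) = S A ⊗ₖ T B := by
  simp [tensorMap]

/-- Complete positivity: `id_k ⊗ T` preserves positive semidefiniteness for every `k`. -/
def IsCompletelyPositive (T : Matrix n n ℂ →ₗ[ℂ] Matrix n n ℂ) : Prop :=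
  ∀ (k : ℕ) (X : Matrix (Fin k × n) (Fin k × n) ℂ), X.PosSemidef →
    (tensorMap (LinearMap.id : Matrix (Fin k) (Fin k) ℂ →ₗ[ℂ] _) T X).PosSemidef

/-- A unital (doubly stochastic) quantum channel. -/
structure IsUnitalChannel (T : Matrix n n ℂ →ₗ[ℂ] Matrix n n ℂ) : Prop where
  completelyPositive : IsCompletelyPositive T
  tracePreserving : ∀ ρ, (T ρ).trace = ρ.trace
  unital : T 1 = 1

/-- The conjugation `ρ ↦ U ρ U†`. -/
def conjBy (U : Matrix n n ℂ) : Matrix n n ℂ →ₗ[ℂ] Matrix n n ℂ :=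
  LinearMap.mulRight ℂ U.conjTranspose ∘ₗ LinearMap.mulLeft ℂ U

theorem conjBy_apply (U ρ : Matrix n n ℂ) : conjBy U ρ = U * ρ * U.conjTranspose := rfl

/-- `T` is a mixture of unitary channels: `T(ρ) = ∑ i, pᵢ Uᵢ ρ Uᵢ†` is a finite convex
combination of conjugations by unitary matrices. -/
def IsMixtureOfUnitaries (T : Matrix n n ℂ →ₗ[ℂ] Matrix n n ℂ) : Prop :=
  ∃ (N : ℕ) (p : Fin N → ℝ) (U : Fin N → Matrix n n ℂ),
    (∀ i, 0 < p i) ∧ ∑ i, p i = 1 ∧ (∀ i, U i ∈ Matrix.unitaryGroup n ℂ) ∧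
      T = ∑ i, (p i : ℂ) • conjBy (U i)

/-- The maximally entangled unit vector `Ω = d^{-1/2} ∑ j, |j, j⟩`, where `d` is the
cardinality of the index type. -/
def maxEntangled (n : Type*) [Fintype n] [DecidableEq n] : n × n → ℂ :=
  fun x => if x.1 = x.2 then ((1 / √(Fintype.card n : ℝ) : ℝ) : ℂ) else 0

/-- The Jamiolkowski operator `(id ⊗ T)(|Ω⟩⟨Ω|)`. -/
def jamiolkowski (T : Matrix n n ℂ →ₗ[ℂ] Matrix n n ℂ) : Matrix (n × n) (n × n) ℂ :=
  tensorMap LinearMap.id T (Matrix.vecMulVec (maxEntangled n) (star (maxEntangled n)))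

end Channels

/-! ### Flip operators and coordinates -/

section Flips

variable (n : Type*) [Fintype n] [DecidableEq n]

/-- The flip operator `|k, l⟩ ↦ |l, k⟩`. -/
def flipOp : Matrix (n × n) (n × n) ℂ := Equiv.Perm.permMatrix ℂ (Equiv.prodComm n n)

/-- For operators on (inputs of both copies) × (outputs of both copies): exchange of the input and
the output of the first copy, `|(a₁, a₂), (b₁, b₂)⟩ ↦ |(b₁, a₂), (a₁, b₂)⟩`. -/
def swapFirst : Equiv.Perm ((n × n) × (n × n)) where
  toFun x := ((x.2.1, x.1.2), (x.1.1, x.2.2))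
  invFun x := ((x.2.1, x.1.2), (x.1.1, x.2.2))
  left_inv _ := rfl
  right_inv _ := rfl

/-- Exchange of the input and the output of the second copy,
`|(a₁, a₂), (b₁, b₂)⟩ ↦ |(a₁, b₂), (b₁, a₂)⟩`. -/
def swapSecond : Equiv.Perm ((n × n) × (n × n)) where
  toFun x := ((x.1.1, x.2.2), (x.2.1, x.1.2))
  invFun x := ((x.1.1, x.2.2), (x.2.1, x.1.2))
  left_inv _ := rfl
  right_inv _ := rfl

/-- The average of the flip of the first copy and the flip of the second copy. -/
def opF : Matrix ((n × n) × (n × n)) ((n × n) × (n × n)) ℂ :=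
  (1 / 2 : ℂ) • ((swapFirst n).permMatrix ℂ + (swapSecond n).permMatrix ℂ)

/-- The tensor product of the flips of both copies. -/
def opF12 : Matrix ((n × n) × (n × n)) ((n × n) × (n × n)) ℂ :=
  (swapFirst n).permMatrix ℂ * (swapSecond n).permMatrix ℂ

variable {n}

/-- The coordinates of a linear map `S` on the matrices of a bipartite system: the expectation
values of `opF` and `opF12` in the Jamiolkowski operator of `S`. -/
def coords (S : Matrix (n × n) (n × n) ℂ →ₗ[ℂ] Matrix (n × n) (n × n) ℂ) : ℂ × ℂ :=
  ((jamiolkowski S * opF n).trace, (jamiolkowski S * opF12 n).trace)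

end Flips

/-- The normalized projection `(1 - flip) / (d (d - 1))` onto the antisymmetric subspace. -/
def rhoMinus (d : ℕ) : Matrix (Fin d × Fin d) (Fin d × Fin d) ℂ :=
  (1 / ((d : ℂ) * ((d : ℂ) - 1))) • (1 - flipOp (Fin d))

/-- The normalized projection `(1 + flip) / (d (d + 1))` onto the symmetric subspace. -/
def rhoPlus (d : ℕ) : Matrix (Fin d × Fin d) (Fin d × Fin d) ℂ :=
  (1 / ((d : ℂ) * ((d : ℂ) + 1))) • (1 + flipOp (Fin d))

/-! ### The family of channels -/

/-- `ρ ↦ (1 + δ) tr[ρ] 1 / d - δ ρᵀ`. -/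
def channelT (d : ℕ) (δ : ℝ) :
    Matrix (Fin d) (Fin d) ℂ →ₗ[ℂ] Matrix (Fin d) (Fin d) ℂ :=
  ((1 + (δ : ℂ)) / (d : ℂ)) • (Matrix.traceLinearMap (Fin d) ℂ ℂ).smulRight 1
    - (δ : ℂ) • (Matrix.transposeLinearEquiv (Fin d) (Fin d) ℂ ℂ).toLinearMap

theorem channelT_apply (d : ℕ) (δ : ℝ) (ρ : Matrix (Fin d) (Fin d) ℂ) :
    channelT d δ ρ =
      ((1 + (δ : ℂ)) / (d : ℂ) * ρ.trace) • (1 : Matrix (Fin d) (Fin d) ℂ)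
        - (δ : ℂ) • ρ.transpose := by
  simp [channelT, smul_smul]

/-- The value of `δ` that belongs to the parameter `ε`. -/
def deltaOf (d : ℕ) (ε : ℝ) : ℝ := 1 / ((d : ℝ) + 1) + (d : ℝ) * ε / ((d : ℝ) ^ 2 - 1)

/-- The threshold for two copies in dimension three. -/
def epsStar : ℝ := 2 / 3 * (4 - 3 * √2 - √3 + √6)

/-! ### The explicit family of unitary `9 × 9` matrices -/

/-- Rows are ordered lexicographically: `(0,0), (0,1), (0,2), (1,0), …, (2,2)`. -/
def matV : Matrix (Fin 3 × Fin 3) (Fin 9) ℂ :=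
  let i := Complex.I
  let a : ℂ := ((1 / √2 : ℝ) : ℂ)
  let b : ℂ := ((1 / (2 * √6) : ℝ) : ℂ)
  let c : ℂ := ((1 / (2 * √2) : ℝ) : ℂ)
  let e : ℂ := ((1 / √3 : ℝ) : ℂ)
  let f : ℂ := ((√(3 / 8) : ℝ) : ℂ)
  let g : ℂ := ((1 / √6 : ℝ) : ℂ)
  Matrix.submatrix
    !![    0,  i * a, -i * b,  0, -i * c,  0,     0,     0, e;
       i * a,      0,     -f,  0,      c,  0,     0,     0, 0;
           0,      0,      0,  0,      0,  a,     0, i * a, 0;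
       i * a,      0,      f,  0,     -c,  0,     0,     0, 0;
           0,      0,  i * g,  0,  i * a,  0,     0,     0, e;
           0,      0,      0,  a,      0,  0, i * a,     0, 0;
           0,      0,      0,  0,      0, -a,     0, i * a, 0;
           0,      0,      0, -a,      0,  0, i * a,     0, 0;
           0, -i * a, -i * b,  0, -i * c,  0,     0,     0, e]
    (finProdFinEquiv : Fin 3 × Fin 3 ≃ Fin 9) id

/-- Four rotation blocks `[[cos θ, -sin θ], [sin θ, cos θ]]` followed by a single `1`. -/
def matD (θ : ℝ) : Matrix (Fin 9) (Fin 9) ℂ :=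
  let c : ℂ := ((Real.cos θ : ℝ) : ℂ)
  let s : ℂ := ((Real.sin θ : ℝ) : ℂ)
  !![c, -s, 0,  0, 0,  0, 0,  0, 0;
     s,  c, 0,  0, 0,  0, 0,  0, 0;
     0,  0, c, -s, 0,  0, 0,  0, 0;
     0,  0, s,  c, 0,  0, 0,  0, 0;
     0,  0, 0,  0, c, -s, 0,  0, 0;
     0,  0, 0,  0, s,  c, 0,  0, 0;
     0,  0, 0,  0, 0,  0, c, -s, 0;
     0,  0, 0,  0, 0,  0, s,  c, 0;
     0,  0, 0,  0, 0,  0, 0,  0, 1]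

/-- The family `U(θ) = V D(θ) Vᵀ`. -/
def matU (θ : ℝ) : Matrix (Fin 3 × Fin 3) (Fin 3 × Fin 3) ℂ :=
  matV * matD θ * matV.transpose

end TwoCopies

end

open scoped Kronecker ComplexOrder

set_option linter.unusedSectionVars false

open Matrix

/-! Single copy: the flip expectation of conjugation by `U` is `tr(U Ū) / 3`. It is real and at
least `-1/3`, because `U - Uᵀ` has operator norm at most two and an antisymmetric `3 × 3` matrix has
rank at most two (`neg_one_le_re_sum_mul_star`). The expectation for the channel is `-1/3 - ε`.

Two copies: the Jamiolkowski matrix of the product lies in the span of `1`, the sum of the two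
flips, and their product. These are the matrices invariant under local twirls and under exchange of
the copies. The twirls preserve the hull of the unitary channels and both coordinates. Instead of
averaging over the group, `exists_twirl_fixed` takes the norm-minimal hull element with prescribed
coordinates: twirls are isometries, so uniqueness of the minimizer makes it invariant. The trace and
the two coordinates then determine it (`isMixtureOfUnitaries_of_coords`), and only a planar question
remains: is `(x, x²)` in the convex set `coordRegion`?

For `x ≥ -1/3` a product `w ⊗ w` of rotations attains the point. Below that, up to the threshold,
the point lies vertically between the curve traced by `matU` and the chord from the meeting point of
curve and parabola to `(1, 1)` (`parabola_mem_coordRegion`). The threshold is a root of a quartic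
that factors over `ℚ(√3)`. -/

namespace TwoCopies

/-! ### Compact convex hulls and norm-minimal points -/

section Compactness

/-- In finite dimension, the convex hull of a compact set is compact. -/
theorem isCompact_convexHull_of_isCompact {E : Type*} [AddCommGroup E] [Module ℝ E]
    [TopologicalSpace E] [ContinuousAdd E] [ContinuousSMul ℝ E] [FiniteDimensional ℝ E]
    {s : Set E} (hs : IsCompact s) : IsCompact (convexHull ℝ s) := by
  rcases s.eq_empty_or_nonempty with rfl | ⟨z₀, hz₀⟩
  · simp
  -- By Carathéodory this many points always suffice, so the hull is the image of a simplex times a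
  -- power of `s`.
  let N := Module.finrank ℝ E + 1
  let F : (Fin N → ℝ) × (Fin N → E) → E := fun q => ∑ i, q.1 i • q.2 i
  have hF : Continuous F := by fun_prop
  have hK : IsCompact (stdSimplex ℝ (Fin N) ×ˢ Set.univ.pi fun _ : Fin N => s) :=
    (isCompact_stdSimplex ℝ (Fin N)).prod (isCompact_univ_pi fun _ => hs)
  convert hK.image hF using 1
  refine Set.Subset.antisymm (fun x hx => ?_) ?_
  · obtain ⟨ι, _, z, w, hz, hind, hw, hsum, rfl⟩ := eq_pos_convex_span_of_mem_convexHull hx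
    have hcard : Fintype.card ι ≤ N :=
      hind.card_le_finrank_succ.trans (Nat.succ_le_succ (Submodule.finrank_le _))
    let f : ι ↪ Fin N := (Fintype.equivFin ι).toEmbedding.trans (Fin.castLEEmb hcard)
    have hout : ∀ k, k ∉ Finset.univ.map f → Function.extend f w 0 k = 0 := fun k hk =>
      Function.extend_apply' _ _ _ fun ⟨i, hi⟩ =>
        hk (Finset.mem_map.2 ⟨i, Finset.mem_univ _, hi⟩)
    -- Shorter combinations are padded with weight zero. The padding point must still lie in `s`,
    -- hence `z₀`.
    refine ⟨(Function.extend f w 0, Function.extend f z fun _ => z₀),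
      ⟨⟨fun k => ?_, ?_⟩, fun k _ => ?_⟩, ?_⟩
    · by_cases hk : ∃ i, f i = k
      · obtain ⟨i, rfl⟩ := hk
        simpa [f.injective.extend_apply] using (hw i).le
      · simp [Function.extend_apply' _ _ _ hk]
    · rw [← hsum, ← Finset.sum_subset (Finset.subset_univ (Finset.univ.map f))
        (fun k _ hk => hout k hk), Finset.sum_map]
      simp [f.injective.extend_apply]
    · by_cases hk : ∃ i, f i = k
      · obtain ⟨i, rfl⟩ := hk
        simpa [f.injective.extend_apply] using hz ⟨i, rfl⟩
      · simpa [Function.extend_apply' _ _ _ hk] using hz₀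
    · change ∑ k, _ = _
      rw [← Finset.sum_subset (Finset.subset_univ (Finset.univ.map f))
        (fun k _ hk => by simp only; rw [hout k hk, zero_smul]), Finset.sum_map]
      simp [f.injective.extend_apply]
  · rintro _ ⟨⟨w, z⟩, ⟨hw, hz⟩, rfl⟩
    exact (convex_convexHull ℝ s).sum_mem (fun i _ => hw.1 i) hw.2
      fun i _ => subset_convexHull ℝ s (hz i trivial)

/-- A nonempty compact convex set contains an element which is the only one of at most its
Euclidean norm. -/
theorem exists_unique_minimal_of_isCompact {ι : Type*} [Fintype ι] {K : Set (ι → ℂ)}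
    (hK : IsCompact K) (hc : Convex ℝ K) (hne : K.Nonempty) :
    ∃ J ∈ K, ∀ J' ∈ K,
      ∑ i, Complex.normSq (J' i) ≤ ∑ i, Complex.normSq (J i) → J' = J := by
  obtain ⟨J, hJ, hmin⟩ := hK.exists_isMinOn hne
    (f := fun v => ∑ i, Complex.normSq (v i)) (by
      apply Continuous.continuousOn
      exact continuous_finsetSum _ fun i _ => Complex.continuous_normSq.comp (continuous_apply i))
  refine ⟨J, hJ, fun J' hJ' hle => ?_⟩
  -- Comparing with the midpoint, the parallelogram law leaves no room for a nonzero `J' - J`.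
  have hmid := isMinOn_iff.1 hmin _ (hc hJ hJ' (by norm_num : (0 : ℝ) ≤ 1 / 2)
    (by norm_num : (0 : ℝ) ≤ 1 / 2) (by norm_num))
  have hpar : ∑ i, Complex.normSq (((1 / 2 : ℝ) • J + (1 / 2 : ℝ) • J') i) =
      (∑ i, Complex.normSq (J i)) / 2 + (∑ i, Complex.normSq (J' i)) / 2
        - (∑ i, Complex.normSq (J' i - J i)) / 4 := by
    simp only [Finset.sum_div, ← Finset.sum_add_distrib, ← Finset.sum_sub_distrib]
    refine Finset.sum_congr rfl fun i _ => ?_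
    simp [Complex.normSq_apply]
    ring
  rw [hpar] at hmid
  have hzero : ∑ i, Complex.normSq (J' i - J i) = 0 :=
    le_antisymm (by linarith) (Finset.sum_nonneg fun i _ => Complex.normSq_nonneg _)
  ext i
  have := (Finset.sum_eq_zero_iff_of_nonneg fun i _ => Complex.normSq_nonneg _).1 hzero i
    (Finset.mem_univ i)
  exact sub_eq_zero.1 (Complex.normSq_eq_zero.1 this)

end Compactness

/-! ### Unnormalized Jamiolkowski matrices -/

section Choi

variable {m n : Type*} [Fintype m] [DecidableEq m] [Fintype n] [DecidableEq n]

/-- The unnormalized Jamiolkowski matrix. -/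
def choi (S : Matrix n n ℂ →ₗ[ℂ] Matrix n n ℂ) : Matrix (n × n) (n × n) ℂ :=
  Matrix.of fun x y => S (Matrix.single x.1 y.1 1) x.2 y.2

theorem choi_apply (S : Matrix n n ℂ →ₗ[ℂ] Matrix n n ℂ) (a b a' b' : n) :
    choi S (a, b) (a', b') = S (Matrix.single a a' 1) b b' := rfl

variable (n) in
/-- `choi` as a real linear map. -/
def choiLin : (Matrix n n ℂ →ₗ[ℂ] Matrix n n ℂ) →ₗ[ℝ] Matrix (n × n) (n × n) ℂ where
  toFun := choi
  map_add' S T := by ext x y; rfl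
  map_smul' c S := by ext x y; rfl

theorem choi_injective :
    Function.Injective (choi : (Matrix n n ℂ →ₗ[ℂ] Matrix n n ℂ) → _) := by
  intro S T h
  refine Matrix.ext_linearMap ℂ fun a a' => LinearMap.ext_ring ?_
  ext b b'
  exact congrFun (congrFun h (a, b)) (a', b')

theorem choi_smul (c : ℂ) (S : Matrix n n ℂ →ₗ[ℂ] Matrix n n ℂ) :
    choi (c • S) = c • choi S := rfl

theorem choi_sum {ι : Type*} (s : Finset ι) (S : ι → Matrix n n ℂ →ₗ[ℂ] Matrix n n ℂ) :
    choi (∑ i ∈ s, S i) = ∑ i ∈ s, choi (S i) :=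
  map_sum (choiLin n) S s

theorem choi_conjBy (U : Matrix n n ℂ) :
    choi (conjBy U) = vecMulVec (vec U) (star (vec U)) := by
  ext ⟨a, b⟩ ⟨a', b'⟩
  rw [choi_apply, conjBy_apply, Matrix.mul_apply]
  simp [vecMulVec_apply, vec, Matrix.mul_apply, Matrix.single_apply, ite_and]

/-- Both sides are linear in `X`, so matrix units suffice, and these are Kronecker products of
matrix units. -/
theorem tensorMap_id_apply (T : Matrix n n ℂ →ₗ[ℂ] Matrix n n ℂ)
    (X : Matrix (m × n) (m × n) ℂ) (a a' : m) (b b' : n) :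
    tensorMap LinearMap.id T X (a, b) (a', b') =
      T (Matrix.of fun i j => X (a, i) (a', j)) b b' := by
  let f : Matrix (m × n) (m × n) ℂ →ₗ[ℂ] ℂ :=
    Matrix.entryLinearMap ℂ ℂ (a, b) (a', b') ∘ₗ tensorMap LinearMap.id T
  let sl : Matrix (m × n) (m × n) ℂ →ₗ[ℂ] Matrix n n ℂ :=
    { toFun := fun X => Matrix.of fun i j => X (a, i) (a', j)
      map_add' := fun _ _ => rfl
      map_smul' := fun _ _ => rfl }
  let g : Matrix (m × n) (m × n) ℂ →ₗ[ℂ] ℂ := Matrix.entryLinearMap ℂ ℂ b b' ∘ₗ T ∘ₗ sl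
  suffices f = g from LinearMap.congr_fun this X
  refine Matrix.ext_linearMap ℂ fun ⟨c, i⟩ ⟨c', i'⟩ => LinearMap.ext_ring ?_
  change tensorMap LinearMap.id T (Matrix.single (c, i) (c', i') 1) (a, b) (a', b') =
    T (sl (Matrix.single (c, i) (c', i') 1)) b b'
  have h1 : Matrix.single (c, i) (c', i') (1 : ℂ) =
      Matrix.single c c' 1 ⊗ₖ Matrix.single i i' 1 := by
    rw [Matrix.single_kronecker_single, mul_one]
  have h2 : sl (Matrix.single (c, i) (c', i') 1) =
      (Matrix.single c c' (1 : ℂ) a a') • Matrix.single i i' (1 : ℂ) := by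
    ext j j'
    rw [h1]
    rfl
  rw [h2, map_smul, h1, tensorMap_kronecker]
  rfl

theorem choi_tensorMap (S : Matrix m m ℂ →ₗ[ℂ] Matrix m m ℂ) (T : Matrix n n ℂ →ₗ[ℂ] Matrix n n ℂ)
    (a₁ b₁ a₁' b₁' : m) (a₂ b₂ a₂' b₂' : n) :
    choi (tensorMap S T) ((a₁, a₂), (b₁, b₂)) ((a₁', a₂'), (b₁', b₂')) =
      choi S (a₁, b₁) (a₁', b₁') * choi T (a₂, b₂) (a₂', b₂') := by
  have h1 : Matrix.single (a₁, a₂) (a₁', a₂') (1 : ℂ) =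
      Matrix.single a₁ a₁' 1 ⊗ₖ Matrix.single a₂ a₂' 1 := by
    rw [Matrix.single_kronecker_single, mul_one]
  rw [choi_apply, h1, tensorMap_kronecker]
  rfl

theorem jamiolkowski_eq (S : Matrix n n ℂ →ₗ[ℂ] Matrix n n ℂ) :
    jamiolkowski S = (1 / (Fintype.card n : ℂ)) • choi S := by
  ext ⟨a, b⟩ ⟨a', b'⟩
  rw [jamiolkowski, tensorMap_id_apply, Matrix.smul_apply, choi_apply]
  have : (Matrix.of fun i j =>
      vecMulVec (maxEntangled n) (star (maxEntangled n)) (a, i) (a', j)) =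
      (1 / (Fintype.card n : ℂ)) • Matrix.single a a' (1 : ℂ) := by
    ext i j
    have hs : ((√(Fintype.card n : ℝ) : ℝ) : ℂ)⁻¹ * ((√(Fintype.card n : ℝ) : ℝ) : ℂ)⁻¹ =
        (Fintype.card n : ℂ)⁻¹ := by
      rw [← mul_inv, ← Complex.ofReal_mul, Real.mul_self_sqrt (Nat.cast_nonneg _)]
      simp
    by_cases h : a = i <;> by_cases h' : a' = j <;>
      simp [vecMulVec_apply, maxEntangled, h, h', hs]
  rw [this, map_smul, Matrix.smul_apply]

theorem trace_mul_permMatrix (M : Matrix m m ℂ) (σ : Equiv.Perm m) :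
    (M * σ.permMatrix ℂ).trace = ∑ x, M (σ x) x := by
  simp only [Matrix.trace, Matrix.diag, Equiv.Perm.permMatrix, PEquiv.mul_toMatrix_toPEquiv,
    Matrix.submatrix_apply, id]
  exact (Equiv.sum_comp σ fun x => M x (σ.symm x)).symm.trans (by simp)

end Choi

/-! ### The two coordinates as sums of matrix entries -/

section Coordinates

variable {n : Type*} [Fintype n] [DecidableEq n]

/-- The coordinates as a function of the unnormalized Jamiolkowski matrix. -/
noncomputable def coordsOfChoi (n : Type*) [Fintype n] [DecidableEq n] :
    Matrix ((n × n) × (n × n)) ((n × n) × (n × n)) ℂ →ₗ[ℝ] ℂ × ℂ where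
  toFun Z := ((1 / (Fintype.card (n × n) : ℂ)) * (Z * opF n).trace,
    (1 / (Fintype.card (n × n) : ℂ)) * (Z * opF12 n).trace)
  map_add' Z Z' := by simp [add_mul, mul_add]
  map_smul' c Z := by
    ext <;> simp <;> ring

theorem coords_eq (S : Matrix (n × n) (n × n) ℂ →ₗ[ℂ] Matrix (n × n) (n × n) ℂ) :
    coords S = coordsOfChoi n (choi S) := by
  simp [coords, coordsOfChoi, jamiolkowski_eq]

theorem trace_mul_opF (Z : Matrix ((n × n) × (n × n)) ((n × n) × (n × n)) ℂ) :
    (Z * opF n).trace = (1 / 2) *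
      (∑ a₁, ∑ a₂, ∑ b₁, ∑ b₂, (Z ((b₁, a₂), (a₁, b₂)) ((a₁, a₂), (b₁, b₂)) +
        Z ((a₁, b₂), (b₁, a₂)) ((a₁, a₂), (b₁, b₂)))) := by
  rw [opF, Matrix.mul_smul, Matrix.trace_smul, Matrix.mul_add, Matrix.trace_add,
    trace_mul_permMatrix, trace_mul_permMatrix, ← Finset.sum_add_distrib, smul_eq_mul]
  simp only [Fintype.sum_prod_type]
  rfl

theorem trace_mul_opF12 (Z : Matrix ((n × n) × (n × n)) ((n × n) × (n × n)) ℂ) :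
    (Z * opF12 n).trace =
      ∑ a₁, ∑ a₂, ∑ b₁, ∑ b₂, Z ((b₁, b₂), (a₁, a₂)) ((a₁, a₂), (b₁, b₂)) := by
  rw [opF12, ← Matrix.permMatrix_mul, trace_mul_permMatrix]
  simp only [Fintype.sum_prod_type]
  rfl

end Coordinates

/-! ### The hull of the unitary channels and its twirl symmetry -/

section Hull

variable (n : Type*) [Fintype n] [DecidableEq n]

/-- The unnormalized Jamiolkowski matrices of the unitary channels. -/
def unitaryChoi : Set (Matrix (n × n) (n × n) ℂ) :=
  (fun U : Matrix n n ℂ => vecMulVec (vec U) (star (vec U))) '' (Matrix.unitaryGroup n ℂ : Set _)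

theorem isCompact_unitaryGroup : IsCompact (Matrix.unitaryGroup n ℂ : Set (Matrix n n ℂ)) := by
  have hsub : (Matrix.unitaryGroup n ℂ : Set (Matrix n n ℂ)) ⊆
      Set.univ.pi fun _ : n => Set.univ.pi fun _ : n => Metric.closedBall (0 : ℂ) 1 := by
    intro U hU i _ j _
    simpa using entry_norm_bound_of_unitary hU i j
  refine IsCompact.of_isClosed_subset
    (isCompact_univ_pi fun _ => isCompact_univ_pi fun _ => isCompact_closedBall _ _) ?_ hsub
  have : (Matrix.unitaryGroup n ℂ : Set (Matrix n n ℂ)) = {U | U * star U = 1} := by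
    ext U
    exact Matrix.mem_unitaryGroup_iff
  rw [this]
  refine isClosed_eq (f := fun U : Matrix n n ℂ => U * Uᴴ) ?_ continuous_const
  exact continuous_id.matrix_mul continuous_id.matrix_conjTranspose

theorem isCompact_unitaryChoi : IsCompact (unitaryChoi n) := by
  refine (isCompact_unitaryGroup n).image ?_
  refine continuous_matrix fun x y => ?_
  change Continuous fun U : Matrix n n ℂ => U x.2 x.1 * star (U y.2 y.1)
  fun_prop

variable {n}

/-- Carathéodory gives finitely many strictly positive weights, and injectivity of `choi` lifts the
identity of matrices back to the maps. -/
theorem isMixtureOfUnitaries_of_choi_mem {S : Matrix n n ℂ →ₗ[ℂ] Matrix n n ℂ}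
    (h : choi S ∈ convexHull ℝ (unitaryChoi n)) : IsMixtureOfUnitaries S := by
  obtain ⟨ι, _, z, w, hz, -, hw, hsum, hS⟩ := eq_pos_convex_span_of_mem_convexHull h
  choose U hU hUz using fun i => hz ⟨i, rfl⟩
  let e := Fintype.equivFin ι
  refine ⟨Fintype.card ι, fun k => w (e.symm k), fun k => U (e.symm k), fun k => hw _,
    (e.symm.sum_comp w).trans hsum, fun k => hU _, choi_injective ?_⟩
  rw [choi_sum, ← hS, ← e.symm.sum_comp]
  refine Finset.sum_congr rfl fun k _ => ?_
  rw [choi_smul, choi_conjBy, ← hUz]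
  ext x y
  simp

/-- This is the third linear condition, next to the two coordinates, that pins down an invariant
element. On generators it is `tr(U† U) = n`. -/
theorem trace_of_mem_unitaryHull {Z : Matrix (n × n) (n × n) ℂ}
    (h : Z ∈ convexHull ℝ (unitaryChoi n)) : Z.trace = Fintype.card n := by
  have hconv : Convex ℝ {Z : Matrix (n × n) (n × n) ℂ | Z.trace = Fintype.card n} := by
    intro X hX Y hY a b _ _ hab
    have hab' : (a : ℂ) + b = 1 := by exact_mod_cast hab
    simp only [Set.mem_ofPred_eq, Matrix.trace_add, Matrix.trace_smul] at *
    rw [hX, hY, Complex.real_smul, Complex.real_smul, ← add_mul, hab', one_mul]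
  refine convexHull_min ?_ hconv h
  rintro _ ⟨U, hU, rfl⟩
  have h1 := congrArg Matrix.trace (Matrix.mem_unitaryGroup_iff'.1 hU)
  rw [Matrix.trace_one, Matrix.star_eq_conjTranspose] at h1
  rw [Set.mem_ofPred_eq, Matrix.trace_vecMulVec, dotProduct_comm, star_vec_dotProduct_vec, h1]

theorem kronecker_self_mem_unitaryGroup {W : Matrix n n ℂ} (hW : W ∈ Matrix.unitaryGroup n ℂ) :
    W ⊗ₖ W ∈ Matrix.unitaryGroup (n × n) ℂ :=
  Matrix.kronecker_mem_unitary hW hW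

/-- The action of `W ⊗ W` on Jamiolkowski matrices. -/
def twirlBy (W : Matrix n n ℂ) (Z : Matrix (n × n) (n × n) ℂ) : Matrix (n × n) (n × n) ℂ :=
  (W ⊗ₖ W) * Z * (W ⊗ₖ W)ᴴ

theorem twirlBy_vecMulVec (W U : Matrix n n ℂ) :
    twirlBy W (vecMulVec (vec U) (star (vec U))) =
      vecMulVec (vec (W * U * Wᵀ)) (star (vec (W * U * Wᵀ))) := by
  rw [twirlBy, Matrix.mul_vecMulVec, Matrix.vecMulVec_mul, ← Matrix.star_mulVec,
    Matrix.kronecker_mulVec_vec]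

theorem transpose_mem_unitaryGroup {W : Matrix n n ℂ} (hW : W ∈ Matrix.unitaryGroup n ℂ) :
    Wᵀ ∈ Matrix.unitaryGroup n ℂ := by
  rw [Matrix.mem_unitaryGroup_iff, Matrix.star_eq_conjTranspose]
  have := congrArg Matrix.transpose (Matrix.mem_unitaryGroup_iff'.1 hW)
  rwa [Matrix.transpose_mul, Matrix.transpose_one] at this

/-- The twirl is linear and sends the generator of `U` to that of the unitary `W * U * Wᵀ`. -/
theorem twirlBy_mem_unitaryHull {W : Matrix n n ℂ} (hW : W ∈ Matrix.unitaryGroup n ℂ)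
    {Z : Matrix (n × n) (n × n) ℂ} (hZ : Z ∈ convexHull ℝ (unitaryChoi n)) :
    twirlBy W Z ∈ convexHull ℝ (unitaryChoi n) := by
  let f : Matrix (n × n) (n × n) ℂ →ₗ[ℝ] Matrix (n × n) (n × n) ℂ :=
    LinearMap.mulRight ℝ (W ⊗ₖ W)ᴴ ∘ₗ LinearMap.mulLeft ℝ (W ⊗ₖ W)
  have hmem : f Z ∈ f '' convexHull ℝ (unitaryChoi n) := ⟨Z, hZ, rfl⟩
  rw [f.image_convexHull] at hmem
  refine convexHull_mono ?_ hmem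
  rintro _ ⟨_, ⟨U, hU, rfl⟩, rfl⟩
  exact ⟨W * U * Wᵀ, mul_mem (mul_mem hW hU) (transpose_mem_unitaryGroup hW),
    (twirlBy_vecMulVec W U).symm⟩

theorem sum_normSq_eq_trace {m : Type*} [Fintype m] (Z : Matrix m m ℂ) :
    ((∑ i, ∑ j, Complex.normSq (Z i j) : ℝ) : ℂ) = (Z * Zᴴ).trace := by
  simp [Matrix.trace, Matrix.mul_apply, Complex.mul_conj]

theorem sum_normSq_conj_unitary {m : Type*} [Fintype m] [DecidableEq m] {Q : Matrix m m ℂ}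
    (hQ : Q ∈ Matrix.unitaryGroup m ℂ) (Z : Matrix m m ℂ) :
    ∑ i, ∑ j, Complex.normSq ((Q * Z * Qᴴ) i j) = ∑ i, ∑ j, Complex.normSq (Z i j) := by
  have h1 : Qᴴ * Q = 1 := Matrix.mem_unitaryGroup_iff'.1 hQ
  have : (Q * Z * Qᴴ) * (Q * Z * Qᴴ)ᴴ = Q * (Z * Zᴴ * Qᴴ) := by
    simp only [Matrix.conjTranspose_mul, Matrix.conjTranspose_conjTranspose, Matrix.mul_assoc]
    rw [← Matrix.mul_assoc Qᴴ Q, h1, Matrix.one_mul]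
  have h2 : (((Q * Z * Qᴴ) * (Q * Z * Qᴴ)ᴴ)).trace = (Z * Zᴴ).trace := by
    rw [this, Matrix.trace_mul_comm, Matrix.mul_assoc, h1, Matrix.mul_one]
  rw [← sum_normSq_eq_trace, ← sum_normSq_eq_trace] at h2
  exact_mod_cast h2

/-- Every nonempty level set of a linear map in the hull of the unitary channels contains an
element fixed by all the twirls that preserve the linear map. -/
theorem exists_twirl_fixed {V : Type*} [AddCommGroup V] [Module ℝ V] [TopologicalSpace V]
    [T1Space V] (φ : Matrix (n × n) (n × n) ℂ →ₗ[ℝ] V) (hφ : Continuous φ) {v : V}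
    (hne : ∃ Z ∈ convexHull ℝ (unitaryChoi n), φ Z = v) :
    ∃ J ∈ convexHull ℝ (unitaryChoi n), φ J = v ∧
      ∀ W ∈ Matrix.unitaryGroup n ℂ, (∀ Z, φ (twirlBy W Z) = φ Z) → twirlBy W J = J := by
  let K : Set (Matrix (n × n) (n × n) ℂ) := convexHull ℝ (unitaryChoi n) ∩ φ ⁻¹' {v}
  have hK : IsCompact K :=
    (isCompact_convexHull_of_isCompact (isCompact_unitaryChoi n)).inter_right
      (isClosed_singleton.preimage hφ)
  have hc : Convex ℝ K :=
    (convex_convexHull ℝ _).inter ((convex_singleton v).linear_preimage φ)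
  obtain ⟨Z, hZ, hZv⟩ := hne
  let e : ((n × n) × (n × n) → ℂ) ≃ₗ[ℝ] Matrix (n × n) (n × n) ℂ :=
    LinearEquiv.curry ℝ ℂ (n × n) (n × n)
  have he : Continuous (e.symm : Matrix (n × n) (n × n) ℂ → _) :=
    continuous_pi fun x => (continuous_apply x.2).comp (continuous_apply x.1)
  have hce : Convex ℝ (e.symm '' K) := hc.linear_image e.symm.toLinearMap
  obtain ⟨J, ⟨J, hJ, rfl⟩, huniq⟩ := exists_unique_minimal_of_isCompact (hK.image he) hce
    ⟨_, Z, ⟨hZ, hZv⟩, rfl⟩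
  refine ⟨J, hJ.1, hJ.2, fun W hW hφW => e.symm.injective ?_⟩
  -- The twirled minimizer stays in the level set with the same norm, so it is the minimizer.
  refine huniq _ ⟨_, ⟨twirlBy_mem_unitaryHull hW hJ.1, ?_⟩, rfl⟩ (le_of_eq ?_)
  · exact (hφW J).trans hJ.2
  · simp only [Fintype.sum_prod_type (f := fun x : (n × n) × (n × n) => Complex.normSq _)]
    exact sum_normSq_conj_unitary (kronecker_self_mem_unitaryGroup hW) J

end Hull

/-! ### Tensors invariant under the unitary group of `ℂ³` -/

section Commutant

theorem permMatrix_mem_unitaryGroup {m : Type*} [Fintype m] [DecidableEq m]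
    (σ : Equiv.Perm m) : σ.permMatrix ℂ ∈ Matrix.unitaryGroup m ℂ := by
  rw [Matrix.mem_unitaryGroup_iff, Matrix.star_eq_conjTranspose,
    Matrix.conjTranspose_permMatrix, ← Matrix.permMatrix_mul]
  simp

/-- A tensor on `ℂ³` fixed by `w ⊗ w ⊗ w̄ ⊗ w̄` for all unitary `w` is a combination of the identity
and the flip. -/
theorem fixed_tensor_eq (G : Fin 3 → Fin 3 → Fin 3 → Fin 3 → ℂ)
    (hG : ∀ w ∈ Matrix.unitaryGroup (Fin 3) ℂ, ∀ i j k l,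
      ∑ i', ∑ j', ∑ k', ∑ l', w i i' * w j j' * star (w k k') * star (w l l') * G i' j' k' l' =
        G i j k l) (i j k l : Fin 3) :
    G i j k l = (if i = k ∧ j = l then G 0 1 0 1 else 0) +
      (if i = l ∧ j = k then G 0 1 1 0 else 0) := by
  let p : Fin 3 → Fin 3 → ℂ := fun m i => if i = m then Complex.I else 1
  have hphase : ∀ m i j k l, p m i * p m j * star (p m k) * star (p m l) * G i j k l =
      G i j k l := by
    intro m i j k l
    have hw : Matrix.diagonal (p m) ∈ Matrix.unitaryGroup (Fin 3) ℂ := by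
      rw [Matrix.mem_unitaryGroup_iff, Matrix.star_eq_conjTranspose,
        Matrix.diagonal_conjTranspose, Matrix.diagonal_mul_diagonal, ← Matrix.diagonal_one]
      congr 1
      ext r
      by_cases h : r = m <;> simp [p, h]
    have := hG _ hw i j k l
    simpa [Matrix.diagonal_apply, apply_ite] using this
  -- The phase is `I` to the difference of two multiplicities, between `-2` and `2`. Since `I` has
  -- order four, invariance forces equal multiplicities in `{i, j}` and `{k, l}`; signs alone would
  -- not.
  have hzero : ∀ i j k l, ¬ (i = k ∧ j = l) → ¬ (i = l ∧ j = k) → G i j k l = 0 := by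
    intro i j k l h1 h2
    by_contra h
    have key : ∀ m, p m i * p m j * star (p m k) * star (p m l) = 1 := fun m =>
      mul_right_cancel₀ h ((hphase m i j k l).trans (one_mul _).symm)
    have hI1 : Complex.I ≠ 1 := fun h => by simpa using congrArg Complex.re h
    have hI2 : -Complex.I ≠ 1 := fun h => by simpa using congrArg Complex.re h
    have hI3 : (-1 : ℂ) ≠ 1 := by norm_num
    have hi := key i
    have hj := key j
    simp only [p] at hi hj
    by_cases hik : i = k
    · subst hik
      have hjl : l ≠ j := fun e => h1 ⟨rfl, e.symm⟩
      by_cases hij : i = j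
      · subst hij
        simp [hjl] at hi
        exact hI1 hi
      · simp [hij, hjl] at hj
        exact hI1 hj
    · by_cases hil : i = l
      · subst hil
        have hjk : k ≠ j := fun e => h2 ⟨rfl, e.symm⟩
        by_cases hij : i = j
        · subst hij
          simp [hjk] at hi
          exact hI1 hi
        · simp [hij, hjk] at hj
          exact hI1 hj
      · by_cases hij : j = i
        · simp [hij, Ne.symm hik, Ne.symm hil] at hi
          exact hI3 hi
        · simp [hij, Ne.symm hik, Ne.symm hil] at hi
          exact hI1 hi
  have hperm : ∀ (σ : Equiv.Perm (Fin 3)) i j k l, G (σ i) (σ j) (σ k) (σ l) = G i j k l := by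
    intro σ i j k l
    have := hG _ (permMatrix_mem_unitaryGroup σ) i j k l
    simpa [PEquiv.toMatrix_apply, apply_ite] using this
  have hex : ∀ i j : Fin 3, i ≠ j → ∃ σ : Equiv.Perm (Fin 3), σ 0 = i ∧ σ 1 = j := by decide
  have hex' : ∀ i : Fin 3, ∃ σ : Equiv.Perm (Fin 3), σ 0 = i := by decide
  have hA : ∀ i j, i ≠ j → G i j i j = G 0 1 0 1 := by
    intro i j hij
    obtain ⟨σ, rfl, rfl⟩ := hex i j hij
    exact hperm σ 0 1 0 1
  have hB : ∀ i j, i ≠ j → G i j j i = G 0 1 1 0 := by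
    intro i j hij
    obtain ⟨σ, rfl, rfl⟩ := hex i j hij
    exact hperm σ 0 1 1 0
  have hC : ∀ i, G i i i i = G 0 0 0 0 := by
    intro i
    obtain ⟨σ, rfl⟩ := hex' i
    exact hperm σ 0 0 0 0
  -- Phases and permutations leave three free values. A Hadamard block mixing two basis vectors
  -- supplies the last relation.
  have hrot : G 0 0 0 0 = G 0 1 0 1 + G 0 1 1 0 := by
    set h : ℂ := ((√2 / 2 : ℝ) : ℂ) with hh
    have hsq : h * h = 1 / 2 := by
      rw [hh, ← Complex.ofReal_mul]
      have : √2 / 2 * (√2 / 2) = (1 / 2 : ℝ) := by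
        have := Real.mul_self_sqrt (show (0 : ℝ) ≤ 2 by norm_num)
        linarith
      rw [this]
      norm_num
    have hstar : star h = h := Complex.conj_ofReal _
    have hw : !![h, h, 0; h, -h, 0; 0, 0, 1] ∈ Matrix.unitaryGroup (Fin 3) ℂ := by
      rw [Matrix.mem_unitaryGroup_iff, Matrix.star_eq_conjTranspose]
      ext r c
      have hstar' : (starRingEnd ℂ) h = h := hstar
      fin_cases r <;> fin_cases c <;>
        simp [Matrix.mul_apply, Fin.sum_univ_three, hstar', hsq] <;> norm_num
    have := hG _ hw 0 0 0 0
    have hstar' : (starRingEnd ℂ) h = h := hstar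
    simp [Fin.sum_univ_three, hstar', hzero] at this
    rw [hC 1, hA 1 0 (by decide), hB 1 0 (by decide)] at this
    have h4 : h * h * h * h = 1 / 4 := by
      rw [hsq, mul_assoc, hsq]
      norm_num
    rw [h4] at this
    linear_combination (-2) * this
  by_cases h1 : i = k ∧ j = l
  · obtain ⟨rfl, rfl⟩ := h1
    by_cases hij : i = j
    · subst hij
      simp [hC, hrot]
    · simp [hij, hA i j hij]
  · by_cases h2 : i = l ∧ j = k
    · obtain ⟨rfl, rfl⟩ := h2
      have hij : i ≠ j := fun e => h1 ⟨e, e.symm⟩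
      simp [hij, hB i j hij]
    · simp [h1, h2, hzero i j k l h1 h2]

end Commutant

/-! ### Twirls in coordinates, and their commutation with the flips -/

section TwirlEntries

variable {n : Type*} [Fintype n] [DecidableEq n]

theorem kronecker_one_mul_apply {α : Type*} (w : Matrix n n ℂ)
    (Z : Matrix ((n × n) × (n × n)) α ℂ) (a₁ a₂ b₁ b₂ : n) (y : α) :
    (((w ⊗ₖ (1 : Matrix n n ℂ)) ⊗ₖ (w ⊗ₖ (1 : Matrix n n ℂ))) * Z) ((a₁, a₂), (b₁, b₂)) y =
      ∑ i, ∑ j, w a₁ i * w b₁ j * Z ((i, a₂), (j, b₂)) y := by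
  rw [Matrix.mul_apply]
  simp only [Fintype.sum_prod_type]
  refine Finset.sum_congr rfl fun i _ => ?_
  rw [Finset.sum_eq_single a₂ (fun x _ hx => by simp [Ne.symm hx]) (by simp)]
  refine Finset.sum_congr rfl fun j _ => ?_
  rw [Finset.sum_eq_single b₂ (fun x _ hx => by simp [Ne.symm hx]) (by simp)]
  simp

theorem one_kronecker_mul_apply {α : Type*} (w : Matrix n n ℂ)
    (Z : Matrix ((n × n) × (n × n)) α ℂ) (a₁ a₂ b₁ b₂ : n) (y : α) :
    ((((1 : Matrix n n ℂ) ⊗ₖ w) ⊗ₖ ((1 : Matrix n n ℂ) ⊗ₖ w)) * Z) ((a₁, a₂), (b₁, b₂)) y =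
      ∑ i, ∑ j, w a₂ i * w b₂ j * Z ((a₁, i), (b₁, j)) y := by
  rw [Matrix.mul_apply]
  simp only [Fintype.sum_prod_type]
  rw [Finset.sum_eq_single a₁ (fun x _ hx => by simp [Ne.symm hx]) (by simp)]
  refine Finset.sum_congr rfl fun i _ => ?_
  rw [Finset.sum_eq_single b₁ (fun x _ hx => by simp [Ne.symm hx]) (by simp)]
  simp

theorem mul_conjTranspose_apply {α β : Type*} [Fintype β] (Y : Matrix α β ℂ) (Q : Matrix β β ℂ)
    (x : α) (y : β) : (Y * Qᴴ) x y = star ((Q * Yᴴ) y x) := by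
  rw [← Matrix.conjTranspose_apply, Matrix.conjTranspose_mul, Matrix.conjTranspose_conjTranspose]

theorem twirlBy_kronecker_one_apply (w : Matrix n n ℂ)
    (Z : Matrix ((n × n) × (n × n)) ((n × n) × (n × n)) ℂ) (a₁ a₂ b₁ b₂ a₁' a₂' b₁' b₂' : n) :
    twirlBy (w ⊗ₖ (1 : Matrix n n ℂ)) Z ((a₁, a₂), (b₁, b₂)) ((a₁', a₂'), (b₁', b₂')) =
      ∑ i, ∑ j, ∑ k, ∑ l, w a₁ i * w b₁ j * star (w a₁' k) * star (w b₁' l) *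
        Z ((i, a₂), (j, b₂)) ((k, a₂'), (l, b₂')) := by
  rw [twirlBy, Matrix.mul_assoc, kronecker_one_mul_apply]
  refine Finset.sum_congr rfl fun i _ => Finset.sum_congr rfl fun j _ => ?_
  rw [mul_conjTranspose_apply, kronecker_one_mul_apply]
  simp only [star_sum, star_mul', Matrix.conjTranspose_apply, star_star, Finset.mul_sum]
  refine Finset.sum_congr rfl fun k _ => Finset.sum_congr rfl fun l _ => ?_
  ring

theorem twirlBy_one_kronecker_apply (w : Matrix n n ℂ)
    (Z : Matrix ((n × n) × (n × n)) ((n × n) × (n × n)) ℂ) (a₁ a₂ b₁ b₂ a₁' a₂' b₁' b₂' : n) :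
    twirlBy ((1 : Matrix n n ℂ) ⊗ₖ w) Z ((a₁, a₂), (b₁, b₂)) ((a₁', a₂'), (b₁', b₂')) =
      ∑ i, ∑ j, ∑ k, ∑ l, w a₂ i * w b₂ j * star (w a₂' k) * star (w b₂' l) *
        Z ((a₁, i), (b₁, j)) ((a₁', k), (b₁', l)) := by
  rw [twirlBy, Matrix.mul_assoc, one_kronecker_mul_apply]
  refine Finset.sum_congr rfl fun i _ => Finset.sum_congr rfl fun j _ => ?_
  rw [mul_conjTranspose_apply, one_kronecker_mul_apply]
  simp only [star_sum, star_mul', Matrix.conjTranspose_apply, star_star, Finset.mul_sum]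
  refine Finset.sum_congr rfl fun k _ => Finset.sum_congr rfl fun l _ => ?_
  ring

theorem permMatrix_mul_eq_mul_permMatrix {m : Type*} [Fintype m] [DecidableEq m]
    {σ τ : Equiv.Perm m} {Q : Matrix m m ℂ} (h : ∀ x y, Q (σ x) (τ y) = Q x y) :
    σ.permMatrix ℂ * Q = Q * τ.permMatrix ℂ := by
  ext x y
  rw [Equiv.Perm.permMatrix, Equiv.Perm.permMatrix, PEquiv.toMatrix_toPEquiv_mul,
    PEquiv.mul_toMatrix_toPEquiv]
  simpa using h x (τ.symm y)

theorem trace_twirl_mul {m : Type*} [Fintype m] [DecidableEq m] {Q F : Matrix m m ℂ}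
    (hQ : Q ∈ Matrix.unitaryGroup m ℂ) (h : F * Q = Q * F) (Z : Matrix m m ℂ) :
    (Q * Z * Qᴴ * F).trace = (Z * F).trace := by
  have h1 : Qᴴ * Q = 1 := Matrix.mem_unitaryGroup_iff'.1 hQ
  rw [Matrix.mul_assoc, Matrix.mul_assoc, Matrix.trace_mul_comm]
  have : Z * (Qᴴ * F) * Q = Z * F := by
    rw [Matrix.mul_assoc, Matrix.mul_assoc, h, ← Matrix.mul_assoc Qᴴ, h1, Matrix.one_mul]
  rw [this]

/-- Cyclicity of the trace reduces this to commutation with `W ⊗ₖ W`. Only `opF` needs a hypothesis: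
`opF12` exchanges the two equal factors `W` as a whole. -/
theorem coordsOfChoi_twirlBy {W : Matrix (n × n) (n × n) ℂ}
    (hW : W ∈ Matrix.unitaryGroup (n × n) ℂ) (h : opF n * (W ⊗ₖ W) = (W ⊗ₖ W) * opF n)
    (Z : Matrix ((n × n) × (n × n)) ((n × n) × (n × n)) ℂ) :
    coordsOfChoi n (twirlBy W Z) = coordsOfChoi n Z := by
  have hQ := kronecker_self_mem_unitaryGroup hW
  have h12 : opF12 n * (W ⊗ₖ W) = (W ⊗ₖ W) * opF12 n := by
    rw [opF12, ← Matrix.permMatrix_mul]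
    refine permMatrix_mul_eq_mul_permMatrix fun ⟨⟨a₁, a₂⟩, b₁, b₂⟩ ⟨⟨a₁', a₂'⟩, b₁', b₂'⟩ => ?_
    exact mul_comm (W (b₁, b₂) (b₁', b₂')) (W (a₁, a₂) (a₁', a₂'))
  change (_ * (_ : ℂ), _ * (_ : ℂ)) = (_, _)
  rw [twirlBy, trace_twirl_mul hQ h, trace_twirl_mul hQ h12]

theorem opF_mul_kronecker (w₁ w₂ : Matrix n n ℂ) :
    opF n * ((w₁ ⊗ₖ w₂) ⊗ₖ (w₁ ⊗ₖ w₂)) = ((w₁ ⊗ₖ w₂) ⊗ₖ (w₁ ⊗ₖ w₂)) * opF n := by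
  rw [opF, Matrix.smul_mul, Matrix.mul_smul, Matrix.add_mul, Matrix.mul_add,
    permMatrix_mul_eq_mul_permMatrix (σ := swapFirst n) (τ := swapFirst n),
    permMatrix_mul_eq_mul_permMatrix (σ := swapSecond n) (τ := swapSecond n)]
  · rintro ⟨⟨a₁, a₂⟩, b₁, b₂⟩ ⟨⟨a₁', a₂'⟩, b₁', b₂'⟩
    simp only [swapSecond, Equiv.coe_fn_mk, Matrix.kroneckerMap_apply]
    ring
  · rintro ⟨⟨a₁, a₂⟩, b₁, b₂⟩ ⟨⟨a₁', a₂'⟩, b₁', b₂'⟩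
    simp only [swapFirst, Equiv.coe_fn_mk, Matrix.kroneckerMap_apply]
    ring

theorem flipOp_apply (a b a' b' : n) :
    flipOp n (a, b) (a', b') = if b = a' ∧ a = b' then 1 else 0 := by
  simp [flipOp, PEquiv.toMatrix_apply]

/-- Exchanging the copies interchanges `swapFirst` and `swapSecond`, so only their average is
preserved. -/
theorem opF_mul_flipOp :
    opF n * (flipOp n ⊗ₖ flipOp n) = (flipOp n ⊗ₖ flipOp n) * opF n := by
  rw [opF, Matrix.smul_mul, Matrix.mul_smul, Matrix.add_mul, Matrix.mul_add,
    permMatrix_mul_eq_mul_permMatrix (σ := swapFirst n) (τ := swapSecond n),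
    permMatrix_mul_eq_mul_permMatrix (σ := swapSecond n) (τ := swapFirst n), add_comm]
  · rintro ⟨⟨a₁, a₂⟩, b₁, b₂⟩ ⟨⟨a₁', a₂'⟩, b₁', b₂'⟩
    simp only [swapFirst, swapSecond, Equiv.coe_fn_mk, Matrix.kroneckerMap_apply, flipOp_apply,
      mul_ite, mul_one, mul_zero, ← ite_and]
    exact if_congr (by tauto) rfl rfl
  · rintro ⟨⟨a₁, a₂⟩, b₁, b₂⟩ ⟨⟨a₁', a₂'⟩, b₁', b₂'⟩
    simp only [swapFirst, swapSecond, Equiv.coe_fn_mk, Matrix.kroneckerMap_apply, flipOp_apply,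
      mul_ite, mul_one, mul_zero, ← ite_and]
    exact if_congr (by tauto) rfl rfl

theorem twirlBy_flipOp_apply (Z : Matrix ((n × n) × (n × n)) ((n × n) × (n × n)) ℂ)
    (a₁ a₂ b₁ b₂ a₁' a₂' b₁' b₂' : n) :
    twirlBy (flipOp n) Z ((a₁, a₂), (b₁, b₂)) ((a₁', a₂'), (b₁', b₂')) =
      Z ((a₂, a₁), (b₂, b₁)) ((a₂', a₁'), (b₂', b₁')) := by
  have : flipOp n ⊗ₖ flipOp n = Equiv.Perm.permMatrix ℂ
      (Equiv.prodCongr (Equiv.prodComm n n) (Equiv.prodComm n n)) := by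
    ext ⟨⟨a₁, a₂⟩, b₁, b₂⟩ ⟨⟨a₁', a₂'⟩, b₁', b₂'⟩
    simp only [flipOp_apply, PEquiv.toMatrix_apply, Matrix.kroneckerMap_apply,
      Equiv.toPEquiv_apply, Equiv.prodCongr_apply, Prod.map, Equiv.prodComm_apply, Prod.swap,
      Option.mem_some_iff, Prod.mk.injEq, mul_ite, mul_one, mul_zero, ← ite_and]
    exact if_congr (by tauto) rfl rfl
  rw [twirlBy, this, mul_conjTranspose_apply, Equiv.Perm.permMatrix, PEquiv.toMatrix_toPEquiv_mul,
    PEquiv.toMatrix_toPEquiv_mul]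
  simp

end TwirlEntries

/-! ### The three-parameter form of invariant matrices -/

section Determination

variable {J : Matrix ((Fin 3 × Fin 3) × (Fin 3 × Fin 3)) ((Fin 3 × Fin 3) × (Fin 3 × Fin 3)) ℂ}

/-- `fixed_tensor_eq` is applied to the indices of one copy with the other copy frozen, then the
other way round. Four constants survive, and exchange of the copies identifies the two mixed ones.
-/
theorem twirl_fixed_eq
    (h1 : ∀ w ∈ Matrix.unitaryGroup (Fin 3) ℂ, twirlBy (w ⊗ₖ (1 : Matrix (Fin 3) (Fin 3) ℂ)) J = J)
    (h2 : ∀ w ∈ Matrix.unitaryGroup (Fin 3) ℂ, twirlBy ((1 : Matrix (Fin 3) (Fin 3) ℂ) ⊗ₖ w) J = J)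
    (h3 : twirlBy (flipOp (Fin 3)) J = J) :
    ∃ p q r : ℂ, ∀ a₁ a₂ b₁ b₂ a₁' a₂' b₁' b₂',
      J ((a₁, a₂), (b₁, b₂)) ((a₁', a₂'), (b₁', b₂')) =
        p * ((1 : Matrix _ _ ℂ) (a₁, b₁) (a₁', b₁') * (1 : Matrix _ _ ℂ) (a₂, b₂) (a₂', b₂')) +
        q * ((1 : Matrix _ _ ℂ) (a₁, b₁) (a₁', b₁') * flipOp (Fin 3) (a₂, b₂) (a₂', b₂') +
          flipOp (Fin 3) (a₁, b₁) (a₁', b₁') * (1 : Matrix _ _ ℂ) (a₂, b₂) (a₂', b₂')) +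
        r * (flipOp (Fin 3) (a₁, b₁) (a₁', b₁') * flipOp (Fin 3) (a₂, b₂) (a₂', b₂')) := by
  have e1 : ∀ a₂ b₂ a₂' b₂' i j k l, J ((i, a₂), (j, b₂)) ((k, a₂'), (l, b₂')) =
      (if i = k ∧ j = l then J ((0, a₂), (1, b₂)) ((0, a₂'), (1, b₂')) else 0) +
      (if i = l ∧ j = k then J ((0, a₂), (1, b₂)) ((1, a₂'), (0, b₂')) else 0) := by
    intro a₂ b₂ a₂' b₂'
    refine fixed_tensor_eq (fun i j k l => J ((i, a₂), (j, b₂)) ((k, a₂'), (l, b₂'))) ?_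
    intro w hw i j k l
    rw [← twirlBy_kronecker_one_apply, h1 w hw]
  have e2 : ∀ a₁ b₁ a₁' b₁' i j k l, J ((a₁, i), (b₁, j)) ((a₁', k), (b₁', l)) =
      (if i = k ∧ j = l then J ((a₁, 0), (b₁, 1)) ((a₁', 0), (b₁', 1)) else 0) +
      (if i = l ∧ j = k then J ((a₁, 0), (b₁, 1)) ((a₁', 1), (b₁', 0)) else 0) := by
    intro a₁ b₁ a₁' b₁'
    refine fixed_tensor_eq (fun i j k l => J ((a₁, i), (b₁, j)) ((a₁', k), (b₁', l))) ?_
    intro w hw i j k l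
    rw [← twirlBy_one_kronecker_apply, h2 w hw]
  have e3 : J ((0, 0), (1, 1)) ((1, 0), (0, 1)) = J ((0, 0), (1, 1)) ((0, 1), (1, 0)) := by
    have := twirlBy_flipOp_apply J 0 0 1 1 1 0 0 1
    rwa [h3] at this
  refine ⟨J ((0, 0), (1, 1)) ((0, 0), (1, 1)), J ((0, 0), (1, 1)) ((0, 1), (1, 0)),
    J ((0, 0), (1, 1)) ((1, 1), (0, 0)), fun a₁ a₂ b₁ b₂ a₁' a₂' b₁' b₂' => ?_⟩
  rw [e1, e2 0 1 0 1, e2 0 1 1 0, e3]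
  simp only [flipOp_apply, Matrix.one_apply, Prod.mk.injEq, and_comm (a := b₁ = a₁'),
    and_comm (a := b₂ = a₂')]
  split_ifs <;> ring

end Determination

/-! ### Reduction of the two-copy problem to the coordinates -/

section MixtureCriterion

theorem choi_channelT (d : ℕ) (δ : ℝ) :
    choi (channelT d δ) = ((1 + (δ : ℂ)) / (d : ℂ)) • (1 : Matrix _ _ ℂ)
      - (δ : ℂ) • flipOp (Fin d) := by
  ext ⟨a, b⟩ ⟨a', b'⟩
  rw [choi_apply, channelT_apply]
  simp only [Matrix.sub_apply, Matrix.smul_apply, Matrix.transpose_apply, flipOp_apply,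
    Matrix.one_apply, Prod.mk.injEq, Matrix.single_apply, smul_eq_mul]
  congr 1
  · by_cases h : a = a'
    · subst h
      simp
    · simp [h, Matrix.trace_single_eq_of_ne a a' (1 : ℂ) h]
  · congr 1
    exact if_congr (by tauto) rfl rfl

/-- In each copy `tr 1 = 9`, `tr 𝔽 = 3` and `𝔽² = 1`; all coefficients are products of these,
divided by `9` for the coordinates. -/
theorem trace_eq_of_commutant
    {J : Matrix ((Fin 3 × Fin 3) × (Fin 3 × Fin 3)) ((Fin 3 × Fin 3) × (Fin 3 × Fin 3)) ℂ}
    {p q r : ℂ} (h : ∀ a₁ a₂ b₁ b₂ a₁' a₂' b₁' b₂',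
      J ((a₁, a₂), (b₁, b₂)) ((a₁', a₂'), (b₁', b₂')) =
        p * ((1 : Matrix _ _ ℂ) (a₁, b₁) (a₁', b₁') * (1 : Matrix _ _ ℂ) (a₂, b₂) (a₂', b₂')) +
        q * ((1 : Matrix _ _ ℂ) (a₁, b₁) (a₁', b₁') * flipOp (Fin 3) (a₂, b₂) (a₂', b₂') +
          flipOp (Fin 3) (a₁, b₁) (a₁', b₁') * (1 : Matrix _ _ ℂ) (a₂, b₂) (a₂', b₂')) +
        r * (flipOp (Fin 3) (a₁, b₁) (a₁', b₁') * flipOp (Fin 3) (a₂, b₂) (a₂', b₂'))) :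
    J.trace = 81 * p + 54 * q + 9 * r ∧
      coordsOfChoi (Fin 3) J = (3 * p + 10 * q + 3 * r, p + 6 * q + 9 * r) := by
  refine ⟨?_, Prod.ext ?_ ?_⟩
  · simp only [Matrix.trace, Matrix.diag, Fintype.sum_prod_type, h, flipOp_apply,
      Matrix.one_apply]
    simp [Fin.sum_univ_three]
    ring
  · change _ * _ = _
    rw [trace_mul_opF]
    simp only [h, flipOp_apply, Matrix.one_apply]
    simp [Fin.sum_univ_three]
    ring
  · change _ * _ = _
    rw [trace_mul_opF12]
    simp only [h, flipOp_apply, Matrix.one_apply]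
    simp [Fin.sum_univ_three]
    ring

theorem choi_tensorMap_channelT (δ : ℝ) (a₁ a₂ b₁ b₂ a₁' a₂' b₁' b₂' : Fin 3) :
    choi (tensorMap (channelT 3 δ) (channelT 3 δ)) ((a₁, a₂), (b₁, b₂)) ((a₁', a₂'), (b₁', b₂')) =
      ((1 + (δ : ℂ)) / 3) ^ 2 *
          ((1 : Matrix _ _ ℂ) (a₁, b₁) (a₁', b₁') * (1 : Matrix _ _ ℂ) (a₂, b₂) (a₂', b₂')) +
        (-((δ : ℂ) * (1 + δ) / 3)) *
          ((1 : Matrix _ _ ℂ) (a₁, b₁) (a₁', b₁') * flipOp (Fin 3) (a₂, b₂) (a₂', b₂') +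
          flipOp (Fin 3) (a₁, b₁) (a₁', b₁') * (1 : Matrix _ _ ℂ) (a₂, b₂) (a₂', b₂')) +
        (δ : ℂ) ^ 2 *
          (flipOp (Fin 3) (a₁, b₁) (a₁', b₁') * flipOp (Fin 3) (a₂, b₂) (a₂', b₂')) := by
  rw [choi_tensorMap, choi_channelT]
  simp only [Matrix.sub_apply, Matrix.smul_apply, smul_eq_mul]
  push_cast
  ring

theorem coords_tensorMap_channelT (δ : ℝ) :
    coords (tensorMap (channelT 3 δ) (channelT 3 δ)) =
      (((1 - 8 * δ) / 3 : ℂ), ((1 - 8 * δ) / 3 : ℂ) ^ 2) := by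
  rw [coords_eq, (trace_eq_of_commutant (choi_tensorMap_channelT δ)).2]
  ext <;> ring

theorem continuous_coordsOfChoi : Continuous (coordsOfChoi (Fin 3)) := by
  refine Continuous.prodMk ?_ ?_
  · exact continuous_const.mul (continuous_id.matrix_mul continuous_const).matrix_trace
  · exact continuous_const.mul (continuous_id.matrix_mul continuous_const).matrix_trace

/-- The invariant hull element with the same coordinates has three coefficients and satisfies three
independent linear equations, which the product channel satisfies too. Hence it is the Jamiolkowski
matrix of the product channel. -/
theorem isMixtureOfUnitaries_of_coords (δ : ℝ)
    (h : ∃ Z ∈ convexHull ℝ (unitaryChoi (Fin 3 × Fin 3)), coordsOfChoi (Fin 3) Z =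
      coords (tensorMap (channelT 3 δ) (channelT 3 δ))) :
    IsMixtureOfUnitaries (tensorMap (channelT 3 δ) (channelT 3 δ)) := by
  obtain ⟨J, hJ, hJc, hfix⟩ := exists_twirl_fixed (coordsOfChoi (Fin 3)) continuous_coordsOfChoi h
  obtain ⟨p, q, r, hpqr⟩ := twirl_fixed_eq (J := J)
    (fun w hw => by
      have hW := Matrix.kronecker_mem_unitary hw (one_mem (Matrix.unitaryGroup (Fin 3) ℂ))
      exact hfix _ hW (coordsOfChoi_twirlBy hW (opF_mul_kronecker _ _)))
    (fun w hw => by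
      have hW := Matrix.kronecker_mem_unitary (one_mem (Matrix.unitaryGroup (Fin 3) ℂ)) hw
      exact hfix _ hW (coordsOfChoi_twirlBy hW (opF_mul_kronecker _ _)))
    (by
      have hW : flipOp (Fin 3) ∈ Matrix.unitaryGroup (Fin 3 × Fin 3) ℂ :=
        permMatrix_mem_unitaryGroup _
      exact hfix _ hW (coordsOfChoi_twirlBy hW opF_mul_flipOp))
  obtain ⟨ht, hc⟩ := trace_eq_of_commutant hpqr
  rw [trace_of_mem_unitaryHull hJ] at ht
  rw [hJc, coords_tensorMap_channelT, Prod.mk.injEq] at hc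
  obtain ⟨hc1, hc2⟩ := hc
  simp only [Fintype.card_prod, Fintype.card_fin] at ht
  push_cast at ht
  refine isMixtureOfUnitaries_of_choi_mem ?_
  convert hJ using 1
  ext ⟨⟨a₁, a₂⟩, b₁, b₂⟩ ⟨⟨a₁', a₂'⟩, b₁', b₂'⟩
  -- The multipliers here and below are the rows of the inverse of the `3 × 3` system for `p`, `q`,
  -- `r`.
  have hp : p = ((1 + (δ : ℂ)) / 3) ^ 2 := by
    linear_combination (-1 / 64) * ht + (3 / 32) * hc1 - (1 / 64) * hc2
  have hq : q = -((δ : ℂ) * (1 + δ) / 3) := by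
    linear_combination (1 / 192) * ht - (5 / 32) * hc1 + (3 / 64) * hc2
  have hr : r = (δ : ℂ) ^ 2 := by
    linear_combination (-1 / 576) * ht + (3 / 32) * hc1 - (9 / 64) * hc2
  rw [choi_tensorMap_channelT, hpqr, hp, hq, hr]

end MixtureCriterion

/-! ### The single channel: complete positivity and the obstruction -/

section SingleCopy

variable {n : Type*} [Fintype n] [DecidableEq n]

theorem tensorMap_id_conjBy {m : Type*} [Fintype m] [DecidableEq m] (K : Matrix n n ℂ)
    (X : Matrix (m × n) (m × n) ℂ) :
    tensorMap LinearMap.id (conjBy K) X =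
      ((1 : Matrix m m ℂ) ⊗ₖ K) * X * ((1 : Matrix m m ℂ) ⊗ₖ K)ᴴ := by
  ext ⟨a, b⟩ ⟨a', b'⟩
  rw [tensorMap_id_apply, conjBy_apply, Matrix.mul_apply, Matrix.mul_apply, Fintype.sum_prod_type,
    Finset.sum_eq_single a' (fun x _ hx => by simp [Ne.symm hx]) (by simp)]
  refine Finset.sum_congr rfl fun j _ => ?_
  rw [Matrix.mul_apply, Matrix.mul_apply, Fintype.sum_prod_type,
    Finset.sum_eq_single a (fun x _ hx => by simp [Ne.symm hx]) (by simp)]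
  simp

theorem isCompletelyPositive_conjBy (K : Matrix n n ℂ) : IsCompletelyPositive (conjBy K) := by
  intro k X hX
  rw [tensorMap_id_conjBy]
  exact hX.mul_mul_conjTranspose_same _

theorem IsCompletelyPositive.add {S T : Matrix n n ℂ →ₗ[ℂ] Matrix n n ℂ}
    (hS : IsCompletelyPositive S) (hT : IsCompletelyPositive T) :
    IsCompletelyPositive (S + T) := by
  intro k X hX
  have : tensorMap LinearMap.id (S + T) X =
      tensorMap LinearMap.id S X + tensorMap LinearMap.id T X := by
    ext ⟨a, b⟩ ⟨a', b'⟩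
    simp [tensorMap_id_apply]
  rw [this]
  exact (hS k X hX).add (hT k X hX)

theorem IsCompletelyPositive.smul {S : Matrix n n ℂ →ₗ[ℂ] Matrix n n ℂ}
    (hS : IsCompletelyPositive S) {c : ℝ} (hc : 0 ≤ c) : IsCompletelyPositive ((c : ℂ) • S) := by
  intro k X hX
  have : tensorMap LinearMap.id ((c : ℂ) • S) X = (c : ℂ) • tensorMap LinearMap.id S X := by
    ext ⟨a, b⟩ ⟨a', b'⟩
    simp [tensorMap_id_apply]
  rw [this]
  exact (hS k X hX).smul (by exact_mod_cast hc)

theorem IsCompletelyPositive.sum {ι : Type*} (s : Finset ι)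
    {S : ι → Matrix n n ℂ →ₗ[ℂ] Matrix n n ℂ}
    (hS : ∀ i ∈ s, IsCompletelyPositive (S i)) : IsCompletelyPositive (∑ i ∈ s, S i) := by
  classical
  induction s using Finset.induction_on with
  | empty =>
    intro k X _
    have : tensorMap LinearMap.id (0 : Matrix n n ℂ →ₗ[ℂ] Matrix n n ℂ) X = 0 := by
      ext ⟨a, b⟩ ⟨a', b'⟩
      simp [tensorMap_id_apply]
    rw [Finset.sum_empty, this]
    exact Matrix.PosSemidef.zero
  | insert i s hi ih =>
    rw [Finset.sum_insert hi]
    exact (hS i (Finset.mem_insert_self _ _)).add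
      (ih fun j hj => hS j (Finset.mem_insert_of_mem hj))

theorem sum_choi_conjBy_single (d : ℕ) (s : ℂ) (hs : s = 1 ∨ s = -1) :
    choi (∑ i, ∑ j, conjBy (Matrix.single i j 1 + s • Matrix.single j i 1 :
      Matrix (Fin d) (Fin d) ℂ)) = (2 : ℂ) • (1 : Matrix _ _ ℂ) + (2 * s) • flipOp (Fin d) := by
  have hss : s * star s = 1 := by rcases hs with rfl | rfl <;> simp
  have hst : star s = s := by rcases hs with rfl | rfl <;> simp
  rw [choi_sum]
  simp only [choi_sum, choi_conjBy]
  ext ⟨a, b⟩ ⟨a', b'⟩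
  simp only [Matrix.sum_apply, vecMulVec_apply, vec, Pi.star_apply, Matrix.add_apply,
    Matrix.smul_apply, smul_eq_mul, star_add, star_mul', hst, add_mul, mul_add,
    Finset.sum_add_distrib, Matrix.single_apply, flipOp_apply, Matrix.one_apply, Prod.mk.injEq]
  rw [hst] at hss
  simp only [ite_and, apply_ite star, star_one, star_zero, mul_ite, ite_mul, mul_one, mul_zero,
    zero_mul, one_mul, Finset.sum_ite_eq', Finset.sum_ite_irrel,
    Finset.sum_const_zero, Finset.mem_univ, if_true, hss]
  simp only [eq_comm (a := a) (b := a'), eq_comm (a := a) (b := b'), eq_comm (a := b) (b := a'),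
    eq_comm (a := b) (b := b')]
  split_ifs <;> ring

/-- A Kraus form: the two sums have Jamiolkowski matrices `2(1 ± 𝔽)`, and the weights come from
matching the coefficients of `1` and `𝔽`. Their nonnegativity is exactly `-1/4 ≤ δ ≤ 1/2`. -/
theorem channelT_three_eq_sum (δ : ℝ) : channelT 3 δ =
    (((1 - 2 * δ) / 12 : ℝ) : ℂ) • (∑ i, ∑ j, conjBy (Matrix.single i j 1 +
      (1 : ℂ) • Matrix.single j i 1 : Matrix (Fin 3) (Fin 3) ℂ)) +
    (((1 + 4 * δ) / 12 : ℝ) : ℂ) • (∑ i, ∑ j, conjBy (Matrix.single i j 1 +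
      (-1 : ℂ) • Matrix.single j i 1 : Matrix (Fin 3) (Fin 3) ℂ)) := by
  refine choi_injective ?_
  have hadd : ∀ S T : Matrix (Fin 3) (Fin 3) ℂ →ₗ[ℂ] Matrix (Fin 3) (Fin 3) ℂ,
      choi (S + T) = choi S + choi T := fun _ _ => rfl
  rw [hadd, choi_channelT, choi_smul, choi_smul, sum_choi_conjBy_single _ _ (Or.inl rfl),
    sum_choi_conjBy_single _ _ (Or.inr rfl)]
  ext x y
  simp only [Matrix.sub_apply, Matrix.add_apply, Matrix.smul_apply, smul_eq_mul]
  push_cast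
  ring

theorem isUnitalChannel_channelT {δ : ℝ} (h1 : -(1 / 4) ≤ δ) (h2 : δ ≤ 1 / 2) :
    IsUnitalChannel (channelT 3 δ) where
  completelyPositive := by
    rw [channelT_three_eq_sum]
    refine IsCompletelyPositive.add
      (IsCompletelyPositive.smul (IsCompletelyPositive.sum _ fun i _ =>
        IsCompletelyPositive.sum _ fun j _ => isCompletelyPositive_conjBy _) (by linarith))
      (IsCompletelyPositive.smul (IsCompletelyPositive.sum _ fun i _ =>
        IsCompletelyPositive.sum _ fun j _ => isCompletelyPositive_conjBy _) (by linarith))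
  tracePreserving ρ := by
    rw [channelT_apply]
    simp
    ring
  unital := by
    rw [channelT_apply, Matrix.transpose_one, ← sub_smul]
    simp

theorem trace_jamiolkowski_mul_flipOp (S : Matrix n n ℂ →ₗ[ℂ] Matrix n n ℂ) :
    (jamiolkowski S * flipOp n).trace =
      (1 / (Fintype.card n : ℂ)) * ∑ a, ∑ b, choi S (b, a) (a, b) := by
  rw [jamiolkowski_eq, Matrix.smul_mul, Matrix.trace_smul, flipOp, trace_mul_permMatrix,
    Fintype.sum_prod_type]
  rfl

theorem trace_jamiolkowski_channelT_mul_flipOp (δ : ℝ) :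
    (jamiolkowski (channelT 3 δ) * flipOp (Fin 3)).trace = (1 - 8 * δ) / 3 := by
  rw [trace_jamiolkowski_mul_flipOp, choi_channelT]
  simp only [Matrix.sub_apply, Matrix.smul_apply, smul_eq_mul, flipOp_apply, Matrix.one_apply]
  simp [Fin.sum_univ_three]
  ring

theorem jamiolkowski_channelT (ε : ℝ) :
    jamiolkowski (channelT 3 (deltaOf 3 ε)) =
      ((1 - 1 / 3 + ε / 2 : ℝ) : ℂ) • rhoMinus 3 + ((1 / 3 - ε / 2 : ℝ) : ℂ) • rhoPlus 3 := by
  rw [jamiolkowski_eq, choi_channelT, deltaOf, rhoMinus, rhoPlus]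
  ext x y
  simp only [Matrix.sub_apply, Matrix.add_apply, Matrix.smul_apply, smul_eq_mul, Fintype.card_fin]
  push_cast
  ring

theorem sum_normSq_unitary_mul {U : Matrix n n ℂ} (hU : U ∈ Matrix.unitaryGroup n ℂ)
    (B : Matrix n n ℂ) :
    ∑ i, ∑ j, Complex.normSq ((U * B) i j) = ∑ i, ∑ j, Complex.normSq (B i j) := by
  have h1 : Uᴴ * U = 1 := Matrix.mem_unitaryGroup_iff'.1 hU
  have h : ((U * B) * (U * B)ᴴ).trace = (B * Bᴴ).trace := by
    rw [Matrix.conjTranspose_mul, Matrix.mul_assoc, Matrix.trace_mul_comm, Matrix.mul_assoc,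
      Matrix.mul_assoc, h1, Matrix.mul_one]
  rw [← sum_normSq_eq_trace, ← sum_normSq_eq_trace] at h
  exact_mod_cast h

/-- `Re tr(U Ū) ≥ -1` for a unitary `3 × 3` matrix, because its antisymmetric part is a
contraction of rank at most two. -/
theorem neg_one_le_re_sum_mul_star {U : Matrix (Fin 3) (Fin 3) ℂ}
    (hU : U ∈ Matrix.unitaryGroup (Fin 3) ℂ) :
    -1 ≤ (∑ a, ∑ b, U a b * star (U b a)).re := by
  set x := U 0 1 - U 1 0 with hx
  set y := U 0 2 - U 2 0 with hy
  set z := U 1 2 - U 2 1 with hz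
  set A := U - Uᵀ with hA
  set s := Complex.normSq x + Complex.normSq y + Complex.normSq z with hs
  have hAeq : A = !![0, x, y; -x, 0, z; -y, -z, 0] := by
    ext i j
    fin_cases i <;> fin_cases j <;> simp [hA, hx, hy, hz]
  -- A Hilbert–Schmidt version of `‖A‖ ≤ 2`, from `|u - v|² ≤ 2|u|² + 2|v|²` and unitary invariance.
  have hbound : ∑ i, ∑ j, Complex.normSq ((A * Aᴴ) i j) ≤
      4 * ∑ i, ∑ j, Complex.normSq (Aᴴ i j) := by
    have h1 := sum_normSq_unitary_mul hU Aᴴ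
    have h2 := sum_normSq_unitary_mul (transpose_mem_unitaryGroup hU) Aᴴ
    have h3 : ∑ i, ∑ j, Complex.normSq ((A * Aᴴ) i j) ≤
        2 * ∑ i, ∑ j, Complex.normSq ((U * Aᴴ) i j) +
          2 * ∑ i, ∑ j, Complex.normSq ((Uᵀ * Aᴴ) i j) := by
      simp only [Finset.mul_sum, ← Finset.sum_add_distrib]
      refine Finset.sum_le_sum fun i _ => Finset.sum_le_sum fun j _ => ?_
      have : (A * Aᴴ) i j = (U * Aᴴ) i j - (Uᵀ * Aᴴ) i j := by
        conv_lhs => rw [hA]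
        rw [Matrix.sub_mul, Matrix.sub_apply]
      rw [this, Complex.normSq_apply, Complex.normSq_apply, Complex.normSq_apply,
        Complex.sub_re, Complex.sub_im]
      nlinarith [sq_nonneg (((U * Aᴴ) i j).re + ((Uᵀ * Aᴴ) i j).re),
        sq_nonneg (((U * Aᴴ) i j).im + ((Uᵀ * Aᴴ) i j).im)]
    linarith
  -- The eigenvalues of `A * Aᴴ` are `s, s, 0`. Rank two is what makes the bound give `s ≤ 4`.
  have hleft : ∑ i, ∑ j, Complex.normSq ((A * Aᴴ) i j) = 2 * s ^ 2 := by
    rw [hAeq]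
    simp [Matrix.mul_apply, Fin.sum_univ_three, Complex.normSq_apply, hs]
    ring
  have hright : ∑ i, ∑ j, Complex.normSq (Aᴴ i j) = 2 * s := by
    rw [hAeq]
    simp [Fin.sum_univ_three, hs, Complex.normSq_neg]
    ring
  have hs0 : 0 ≤ s := by
    linarith [Complex.normSq_nonneg x, Complex.normSq_nonneg y, Complex.normSq_nonneg z]
  have hs4 : s ≤ 4 := by
    rw [hleft, hright] at hbound
    by_contra h
    nlinarith
  have hone : ∑ i, ∑ j, Complex.normSq (U i j) = 3 := by
    have := sum_normSq_eq_trace U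
    have h1 : U * Uᴴ = 1 := Matrix.mem_unitaryGroup_iff.1 hU
    rw [h1, Matrix.trace_one] at this
    have h3 : ((∑ i, ∑ j, Complex.normSq (U i j) : ℝ) : ℂ) = ((3 : ℝ) : ℂ) := by
      rw [this]
      simp
    exact_mod_cast h3
  have hre : (∑ a, ∑ b, U a b * star (U b a)).re = 3 - s := by
    rw [← hone]
    simp [Fin.sum_univ_three, hs, hx, hy, hz, Complex.normSq_apply]
    ring
  rw [hre]
  linarith

/-- A mixture has flip expectation at least `-1/3`, whereas here it is `(1 - 8δ)/3 < -1/3`. -/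
theorem not_isMixtureOfUnitaries_channelT {δ : ℝ} (h : 1 / 4 < δ) :
    ¬ IsMixtureOfUnitaries (channelT 3 δ) := by
  rintro ⟨N, p, U, hp, hsum, hU, hT⟩
  have htr := trace_jamiolkowski_channelT_mul_flipOp δ
  rw [trace_jamiolkowski_mul_flipOp, hT, choi_sum] at htr
  have hre := congrArg Complex.re htr
  have hval : ((1 / (Fintype.card (Fin 3) : ℂ)) *
      ∑ a, ∑ b, (∑ i, choi ((p i : ℂ) • conjBy (U i))) (b, a) (a, b)).re =
      1 / 3 * ∑ i, p i * (∑ a, ∑ b, U i a b * star (U i b a)).re := by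
    have : ∑ a, ∑ b, (∑ i, choi ((p i : ℂ) • conjBy (U i))) (b, a) (a, b) =
        ∑ i, (p i : ℂ) * ∑ a, ∑ b, U i a b * star (U i b a) := by
      simp only [choi_smul, choi_conjBy, Matrix.sum_apply, Matrix.smul_apply, vecMulVec_apply, vec,
        Pi.star_apply, smul_eq_mul, Finset.mul_sum]
      rw [Finset.sum_comm' (t' := Finset.univ) (s' := fun _ => Finset.univ) (by simp),
        Finset.sum_congr rfl fun b _ => Finset.sum_comm, Finset.sum_comm]
      refine Finset.sum_congr rfl fun i _ => ?_
      exact Finset.sum_comm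
    have h3 : (1 / (Fintype.card (Fin 3) : ℂ)) = ((1 / 3 : ℝ) : ℂ) := by simp
    rw [this, h3, Complex.re_ofReal_mul, Complex.re_sum]
    simp only [Complex.re_ofReal_mul]
  rw [hval] at hre
  have hlow : -1 ≤ ∑ i, p i * (∑ a, ∑ b, U i a b * star (U i b a)).re := by
    calc (-1 : ℝ) = ∑ i, p i * (-1) := by rw [← Finset.sum_mul, hsum, one_mul]
      _ ≤ _ := Finset.sum_le_sum fun i _ =>
        mul_le_mul_of_nonneg_left (neg_one_le_re_sum_mul_star (hU i)) (hp i).le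
  have h4 : (((1 : ℂ) - 8 * δ) / 3).re = (1 - 8 * δ) / 3 := by
    rw [show ((1 : ℂ) - 8 * δ) / 3 = (((1 - 8 * δ) / 3 : ℝ) : ℂ) by push_cast; rfl,
      Complex.ofReal_re]
  rw [h4] at hre
  linarith

end SingleCopy

/-! ### Unitarity and closed form of the explicit family -/

section UnitaryFamily

/-- The matrix `U(θ)` in the lexicographic basis, with `c = cos θ`, `s = sin θ` and `r = √3`. -/
noncomputable def explicitU (c s r : ℂ) : Matrix (Fin 9) (Fin 9) ℂ :=
  let I := Complex.I
  !![(1 - 2 * c) / 3, -s / 2, I * s / 4, -s / 2, (1 + c) / 3, I * s * r / 12, -I * s / 4, -I * s * r / 12, (1 + c) / 3;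
     s / 2, 0, -s / 4, -c, 0, s * r / 4, s / 4, -s * r / 4, -s / 2;
     -I * s / 4, s / 4, 0, -s / 4, I * s / 2, -s / 2, -c, -s / 2, -I * s / 4;
     s / 2, -c, s / 4, 0, 0, -s * r / 4, -s / 4, s * r / 4, -s / 2;
     (1 + c) / 3, 0, -I * s / 2, 0, (1 - 2 * c) / 3, -I * s * r / 6, I * s / 2, I * s * r / 6, (1 + c) / 3;
     -I * s * r / 12, -s * r / 4, s / 2, s * r / 4, I * s * r / 6, 0, s / 2, -c, -I * s * r / 12;
     I * s / 4, -s / 4, -c, s / 4, -I * s / 2, -s / 2, 0, -s / 2, I * s / 4;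
     I * s * r / 12, s * r / 4, s / 2, -s * r / 4, -I * s * r / 6, -c, s / 2, 0, I * s * r / 12;
     (1 + c) / 3, s / 2, I * s / 4, s / 2, (1 + c) / 3, I * s * r / 12, -I * s / 4, -I * s * r / 12, (1 - 2 * c) / 3]

/-- The matrix `V` in the lexicographic basis, with `q = √2` and `r = √3`. -/
noncomputable def explicitV (q r : ℂ) : Matrix (Fin 9) (Fin 9) ℂ :=
  let i := Complex.I
  let a : ℂ := q / 2
  let b : ℂ := q * r / 12
  let c : ℂ := q / 4
  let e : ℂ := r / 3
  let f : ℂ := q * r / 4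
  let g : ℂ := q * r / 6
  !![    0,  i * a, -i * b,  0, -i * c,  0,     0,     0, e;
     i * a,      0,     -f,  0,      c,  0,     0,     0, 0;
         0,      0,      0,  0,      0,  a,     0, i * a, 0;
     i * a,      0,      f,  0,     -c,  0,     0,     0, 0;
         0,      0,  i * g,  0,  i * a,  0,     0,     0, e;
         0,      0,      0,  a,      0,  0, i * a,     0, 0;
         0,      0,      0,  0,      0, -a,     0, i * a, 0;
         0,      0,      0, -a,      0,  0, i * a,     0, 0;
         0, -i * a, -i * b,  0, -i * c,  0,     0,     0, e]

theorem sqrt_six_eq : √6 = √2 * √3 := by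
  rw [← Real.sqrt_mul (by norm_num)]
  norm_num

/-- All radicals become polynomials in `√2` and `√3`, so later entrywise identities need only `q² =
2`, `r² = 3` and `I² = -1`. -/
theorem matV_eq : matV = (explicitV ((√2 : ℝ) : ℂ) ((√3 : ℝ) : ℂ)).submatrix
    (finProdFinEquiv : Fin 3 × Fin 3 ≃ Fin 9) id := by
  have h2 : √2 * √2 = (2 : ℝ) := Real.mul_self_sqrt (by norm_num)
  have h3 : √3 * √3 = (3 : ℝ) := Real.mul_self_sqrt (by norm_num)
  have h2' : √2 ≠ (0 : ℝ) := by positivity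
  have h3' : √3 ≠ (0 : ℝ) := by positivity
  have ea : 1 / √2 = √2 / 2 := by
    rw [div_eq_div_iff h2' (by norm_num)]
    linarith
  have eb : 1 / (2 * √6) = √2 * √3 / 12 := by
    rw [sqrt_six_eq, div_eq_div_iff (by positivity) (by norm_num)]
    linear_combination (-2 * √3 * √3) * h2 - 4 * h3
  have ec : 1 / (2 * √2) = √2 / 4 := by
    rw [div_eq_div_iff (by positivity) (by norm_num)]
    linarith
  have ee : 1 / √3 = √3 / 3 := by
    rw [div_eq_div_iff h3' (by norm_num)]
    linarith
  have ef : √(3 / 8) = √2 * √3 / 4 := by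
    rw [Real.sqrt_eq_iff_mul_self_eq (by norm_num) (by positivity)]
    linear_combination (-√3 * √3 / 16) * h2 - (1 / 8) * h3
  have eg : 1 / √6 = √2 * √3 / 6 := by
    rw [sqrt_six_eq, div_eq_div_iff (by positivity) (by norm_num)]
    linear_combination (-√3 * √3) * h2 - 2 * h3
  rw [matV, explicitV, ea, eb, ec, ee, ef, eg]
  push_cast
  rfl

/-- The product of `explicitV` with the rotation blocks. -/
noncomputable def explicitVD (q r c s : ℂ) : Matrix (Fin 9) (Fin 9) ℂ :=
  Matrix.of fun p k =>
    ![explicitV q r p 0 * c + explicitV q r p 1 * s, explicitV q r p 1 * c - explicitV q r p 0 * s,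
      explicitV q r p 2 * c + explicitV q r p 3 * s, explicitV q r p 3 * c - explicitV q r p 2 * s,
      explicitV q r p 4 * c + explicitV q r p 5 * s, explicitV q r p 5 * c - explicitV q r p 4 * s,
      explicitV q r p 6 * c + explicitV q r p 7 * s, explicitV q r p 7 * c - explicitV q r p 6 * s,
      explicitV q r p 8] k

theorem explicitV_mul_matD (q r : ℂ) (θ : ℝ) :
    explicitV q r * matD θ = explicitVD q r ((Real.cos θ : ℝ) : ℂ) ((Real.sin θ : ℝ) : ℂ) := by
  ext p k
  fin_cases k <;>
    simp [Matrix.mul_apply, Fin.sum_univ_succ, matD, explicitVD] <;> ring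

set_option maxHeartbeats 4000000 in
theorem explicitVD_mul_transpose {q r : ℂ} (hq : q ^ 2 = 2) (hr : r ^ 2 = 3) (c s : ℂ) :
    explicitVD q r c s * (explicitV q r)ᵀ = explicitU c s r := by
  have hI := Complex.I_sq
  ext p k
  fin_cases p <;> fin_cases k <;>
    simp [Matrix.mul_apply, Fin.sum_univ_succ, explicitV, explicitVD, explicitU] <;>
    ring_nf <;> simp only [hq, hr, hI] <;> ring

set_option maxHeartbeats 4000000 in
theorem explicitV_mem_unitaryGroup {q r : ℝ} (hq : q ^ 2 = 2) (hr : r ^ 2 = 3) :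
    explicitV (q : ℂ) (r : ℂ) ∈ Matrix.unitaryGroup (Fin 9) ℂ := by
  have hI := Complex.I_sq
  have hq' : (q : ℂ) ^ 2 = 2 := by exact_mod_cast hq
  have hr' : (r : ℂ) ^ 2 = 3 := by exact_mod_cast hr
  rw [Matrix.mem_unitaryGroup_iff, Matrix.star_eq_conjTranspose]
  ext p k
  fin_cases p <;> fin_cases k <;>
    simp [Matrix.mul_apply, Fin.sum_univ_succ, explicitV, Complex.conj_ofNat] <;>
    ring_nf <;> simp only [hq', hr', hI] <;> ring

theorem matD_mem_unitaryGroup (θ : ℝ) : matD θ ∈ Matrix.unitaryGroup (Fin 9) ℂ := by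
  have h : ((Real.cos θ : ℝ) : ℂ) ^ 2 + ((Real.sin θ : ℝ) : ℂ) ^ 2 = 1 := by
    exact_mod_cast Real.cos_sq_add_sin_sq θ
  rw [Matrix.mem_unitaryGroup_iff, Matrix.star_eq_conjTranspose]
  generalize hc : Real.cos θ = c at h
  generalize hs : Real.sin θ = s at h
  ext p k
  fin_cases p <;> fin_cases k <;>
    simp [Matrix.mul_apply, Fin.sum_univ_succ, matD, hc, hs, -Complex.ofReal_cos,
      -Complex.ofReal_sin] <;> first | linear_combination h | ring

end UnitaryFamily

/-! ### Coordinates of the explicit family -/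

section UnitaryFamilyCoords

theorem matU_eq_mul (θ : ℝ) :
    matU θ = (explicitV ((√2 : ℝ) : ℂ) ((√3 : ℝ) : ℂ) * matD θ *
      (explicitV ((√2 : ℝ) : ℂ) ((√3 : ℝ) : ℂ))ᵀ).submatrix
        (finProdFinEquiv : Fin 3 × Fin 3 ≃ Fin 9) (finProdFinEquiv : Fin 3 × Fin 3 ≃ Fin 9) := by
  rw [matU, matV_eq]
  rfl

theorem matU_eq (θ : ℝ) :
    matU θ = (explicitU ((Real.cos θ : ℝ) : ℂ) ((Real.sin θ : ℝ) : ℂ) ((√3 : ℝ) : ℂ)).submatrix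
      (finProdFinEquiv : Fin 3 × Fin 3 ≃ Fin 9) (finProdFinEquiv : Fin 3 × Fin 3 ≃ Fin 9) := by
  have h2 : ((√2 : ℝ) : ℂ) ^ 2 = 2 := by
    exact_mod_cast Real.sq_sqrt (show (0 : ℝ) ≤ 2 by norm_num)
  have h3 : ((√3 : ℝ) : ℂ) ^ 2 = 3 := by
    exact_mod_cast Real.sq_sqrt (show (0 : ℝ) ≤ 3 by norm_num)
  rw [matU_eq_mul, explicitV_mul_matD, explicitVD_mul_transpose h2 h3]

theorem matU_mem_unitaryGroup (θ : ℝ) : matU θ ∈ Matrix.unitaryGroup (Fin 3 × Fin 3) ℂ := by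
  have hV := explicitV_mem_unitaryGroup (Real.sq_sqrt (show (0 : ℝ) ≤ 2 by norm_num))
    (Real.sq_sqrt (show (0 : ℝ) ≤ 3 by norm_num))
  have hU := mul_mem (mul_mem hV (matD_mem_unitaryGroup θ)) (transpose_mem_unitaryGroup hV)
  rw [matU_eq_mul, Matrix.mem_unitaryGroup_iff, Matrix.star_eq_conjTranspose,
    Matrix.conjTranspose_submatrix, Matrix.submatrix_mul_equiv]
  rw [Matrix.mem_unitaryGroup_iff, Matrix.star_eq_conjTranspose] at hU
  rw [hU, Matrix.submatrix_one_equiv]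

theorem coords_conjBy (U : Matrix (Fin 3 × Fin 3) (Fin 3 × Fin 3) ℂ) :
    coords (conjBy U) =
      (1 / 18 * ∑ a₁, ∑ a₂, ∑ b₁, ∑ b₂,
        (U (a₁, b₂) (b₁, a₂) * star (U (b₁, b₂) (a₁, a₂)) +
          U (b₁, a₂) (a₁, b₂) * star (U (b₁, b₂) (a₁, a₂))),
      1 / 9 * ∑ a₁, ∑ a₂, ∑ b₁, ∑ b₂, U (a₁, a₂) (b₁, b₂) * star (U (b₁, b₂) (a₁, a₂))) := by
  rw [coords_eq, choi_conjBy]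
  refine Prod.ext ?_ ?_
  · change _ * _ = _
    rw [trace_mul_opF, ← mul_assoc]
    congr 1
    norm_num
  · change _ * _ = _
    rw [trace_mul_opF12]
    congr 1

set_option maxHeartbeats 4000000 in
theorem coords_conjBy_explicitU {c s r : ℝ} (hcs : c ^ 2 + s ^ 2 = 1) (hr : r ^ 2 = 3) :
    coords (conjBy ((explicitU c s r).submatrix (finProdFinEquiv : Fin 3 × Fin 3 ≃ Fin 9)
      (finProdFinEquiv : Fin 3 × Fin 3 ≃ Fin 9))) =
    (((1 / 9 * (-(8 / 3) * (c + 1) ^ 2 + 3) : ℝ) : ℂ),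
      ((1 / 9 * (16 * c ^ 2 - 7) : ℝ) : ℂ)) := by
  have hI := Complex.I_sq
  have hs' : (s : ℂ) ^ 2 = 1 - (c : ℂ) ^ 2 := by
    rw [eq_sub_iff_add_eq']
    exact_mod_cast hcs
  have hr' : (r : ℂ) ^ 2 = 3 := by exact_mod_cast hr
  have e0 : (finProdFinEquiv ((0 : Fin 3), (0 : Fin 3)) : Fin 9) = 0 := rfl
  have e1 : (finProdFinEquiv ((0 : Fin 3), (1 : Fin 3)) : Fin 9) = 1 := rfl
  have e2 : (finProdFinEquiv ((0 : Fin 3), (2 : Fin 3)) : Fin 9) = 2 := rfl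
  have e3 : (finProdFinEquiv ((1 : Fin 3), (0 : Fin 3)) : Fin 9) = 3 := rfl
  have e4 : (finProdFinEquiv ((1 : Fin 3), (1 : Fin 3)) : Fin 9) = 4 := rfl
  have e5 : (finProdFinEquiv ((1 : Fin 3), (2 : Fin 3)) : Fin 9) = 5 := rfl
  have e6 : (finProdFinEquiv ((2 : Fin 3), (0 : Fin 3)) : Fin 9) = 6 := rfl
  have e7 : (finProdFinEquiv ((2 : Fin 3), (1 : Fin 3)) : Fin 9) = 7 := rfl
  have e8 : (finProdFinEquiv ((2 : Fin 3), (2 : Fin 3)) : Fin 9) = 8 := rfl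
  rw [coords_conjBy]
  simp only [Matrix.submatrix_apply, Fin.sum_univ_three, e0, e1, e2, e3, e4, e5, e6, e7, e8]
  refine Prod.ext ?_ ?_
  -- In the first coordinate the terms in `s` cancel identically; only the second uses `s² = 1 -
  -- c²`.
  · simp [explicitU]
    ring
  · simp [explicitU]
    ring_nf
    simp only [hr', hI, hs']
    ring

theorem coords_conjBy_matU (θ : ℝ) : coords (conjBy (matU θ)) =
    (((1 / 9 * (-(8 / 3) * (Real.cos θ + 1) ^ 2 + 3) : ℝ) : ℂ),
      ((1 / 9 * (16 * Real.cos θ ^ 2 - 7) : ℝ) : ℂ)) := by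
  rw [matU_eq]
  exact coords_conjBy_explicitU (Real.cos_sq_add_sin_sq θ)
    (Real.sq_sqrt (show (0 : ℝ) ≤ 3 by norm_num))

end UnitaryFamilyCoords

/-! ### The convex region of attainable coordinates -/

section CoordinateRegion

/-- The real coordinate pairs of the mixtures of unitary channels. -/
def coordRegion : Set (ℝ × ℝ) :=
  {v | ∃ Z ∈ convexHull ℝ (unitaryChoi (Fin 3 × Fin 3)),
    coordsOfChoi (Fin 3) Z = ((v.1 : ℂ), (v.2 : ℂ))}

theorem convex_coordRegion : Convex ℝ coordRegion := by
  rintro v ⟨Z, hZ, hv⟩ v' ⟨Z', hZ', hv'⟩ a b ha hb hab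
  refine ⟨a • Z + b • Z', convex_convexHull ℝ _ hZ hZ' ha hb hab, ?_⟩
  rw [map_add, map_smul, map_smul, hv, hv']
  ext <;> simp

theorem mem_coordRegion_of_unitary {U : Matrix (Fin 3 × Fin 3) (Fin 3 × Fin 3) ℂ}
    (hU : U ∈ Matrix.unitaryGroup (Fin 3 × Fin 3) ℂ) {x y : ℝ}
    (h : coords (conjBy U) = ((x : ℂ), (y : ℂ))) : (x, y) ∈ coordRegion :=
  ⟨_, subset_convexHull ℝ _ ⟨U, hU, rfl⟩,
    (congrArg _ (choi_conjBy U).symm).trans ((coords_eq _).symm.trans h)⟩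

theorem exists_angle {c : ℝ} (h0 : 0 ≤ c) (h1 : c ≤ 1) :
    ∃ θ ∈ Set.Icc (0 : ℝ) (Real.pi / 2), Real.cos θ = c :=
  ⟨Real.arccos c, ⟨Real.arccos_nonneg c, Real.arccos_le_pi_div_two.2 h0⟩,
    Real.cos_arccos (by linarith) h1⟩

theorem curve_mem_coordRegion {c : ℝ} (h0 : 0 ≤ c) (h1 : c ≤ 1) :
    (1 / 9 * (-(8 / 3) * (c + 1) ^ 2 + 3), 1 / 9 * (16 * c ^ 2 - 7)) ∈ coordRegion := by
  obtain ⟨θ, -, rfl⟩ := exists_angle h0 h1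
  exact mem_coordRegion_of_unitary (matU_mem_unitaryGroup θ) (coords_conjBy_matU θ)

/-- Product unitaries `w ⊗ w` give points of the parabola. For a plane rotation `w`, `tr(w w̄) = 1 +
2(c² - s²)`; setting this equal to `3x` gives the values of `c` and `s`, real exactly for `x` in
this range. -/
theorem square_mem_coordRegion {x : ℝ} (h0 : -(1 / 3) ≤ x) (h1 : x ≤ 1) :
    (x, x ^ 2) ∈ coordRegion := by
  set c := √((3 * x + 1) / 4) with hc
  set s := √((3 - 3 * x) / 4) with hs
  have hc2 : c ^ 2 = (3 * x + 1) / 4 := Real.sq_sqrt (by linarith)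
  have hs2 : s ^ 2 = (3 - 3 * x) / 4 := Real.sq_sqrt (by linarith)
  have hc' : (c : ℂ) ^ 2 = (3 * x + 1) / 4 := by exact_mod_cast hc2
  have hs' : (s : ℂ) ^ 2 = (3 - 3 * x) / 4 := by exact_mod_cast hs2
  let w : Matrix (Fin 3) (Fin 3) ℂ := !![(c : ℂ), -s, 0; s, c, 0; 0, 0, 1]
  have hw : w ∈ Matrix.unitaryGroup (Fin 3) ℂ := by
    rw [Matrix.mem_unitaryGroup_iff, Matrix.star_eq_conjTranspose]
    ext i j
    fin_cases i <;> fin_cases j <;> simp [w, Matrix.mul_apply, Fin.sum_univ_three] <;>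
      first | linear_combination hc' + hs' | ring
  have hself : ∑ a, ∑ b, w a b * star (w a b) = 3 := by
    simp [w, Fin.sum_univ_three]
    linear_combination 2 * hc' + 2 * hs'
  have hflip : ∑ a, ∑ b, w a b * star (w b a) = 3 * x := by
    simp [w, Fin.sum_univ_three]
    linear_combination 2 * hc' - 2 * hs'
  refine mem_coordRegion_of_unitary (Matrix.kronecker_mem_unitary hw hw) ?_
  have hsum : ∀ f g : Fin 3 → Fin 3 → ℂ,
      ∑ a₁, ∑ a₂, ∑ b₁, ∑ b₂, f a₁ b₁ * g a₂ b₂ =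
        (∑ a, ∑ b, f a b) * ∑ a, ∑ b, g a b := by
    intro f g
    simp only [Fin.sum_univ_three]
    ring
  rw [coords_conjBy]
  refine Prod.ext ?_ ?_
  · have : ∀ a₁ a₂ b₁ b₂ : Fin 3,
        (w ⊗ₖ w) (a₁, b₂) (b₁, a₂) * star ((w ⊗ₖ w) (b₁, b₂) (a₁, a₂)) +
          (w ⊗ₖ w) (b₁, a₂) (a₁, b₂) * star ((w ⊗ₖ w) (b₁, b₂) (a₁, a₂)) =
        (w a₁ b₁ * star (w b₁ a₁)) * (w b₂ a₂ * star (w b₂ a₂)) +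
          (w b₁ a₁ * star (w b₁ a₁)) * (w a₂ b₂ * star (w b₂ a₂)) := by
      intro a₁ a₂ b₁ b₂
      simp only [Matrix.kroneckerMap_apply, star_mul']
      ring
    simp only [this, Finset.sum_add_distrib]
    rw [hsum (fun a₁ b₁ => w a₁ b₁ * star (w b₁ a₁)) (fun a₂ b₂ => w b₂ a₂ * star (w b₂ a₂)),
      hsum (fun a₁ b₁ => w b₁ a₁ * star (w b₁ a₁)) (fun a₂ b₂ => w a₂ b₂ * star (w b₂ a₂)),
      Finset.sum_comm (f := fun a b => w b a * star (w b a)), hself, hflip]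
    ring
  · have : ∀ a₁ a₂ b₁ b₂ : Fin 3,
        (w ⊗ₖ w) (a₁, a₂) (b₁, b₂) * star ((w ⊗ₖ w) (b₁, b₂) (a₁, a₂)) =
        (w a₁ b₁ * star (w b₁ a₁)) * (w a₂ b₂ * star (w b₂ a₂)) := by
      intro a₁ a₂ b₁ b₂
      simp only [Matrix.kroneckerMap_apply, star_mul']
      ring
    simp only [this]
    rw [hsum (fun a₁ b₁ => w a₁ b₁ * star (w b₁ a₁)) (fun a₂ b₂ => w a₂ b₂ * star (w b₂ a₂)),
      hflip]
    push_cast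
    ring

end CoordinateRegion

/-! ### The meeting point of curve and parabola -/

section Threshold

/-- The parameter of the meeting point of the parabola and the curve, `(2 / 3) (cos θ + 1)`. -/
noncomputable def wStar : ℝ := √3 - (√6 - √2) / 2

theorem sqrt_two_bounds : 1.41421 < √2 ∧ √2 < 1.41422 :=
  ⟨Real.lt_sqrt_of_sq_lt (by norm_num), (Real.sqrt_lt' (by norm_num)).2 (by norm_num)⟩

theorem sqrt_three_bounds : 1.73205 < √3 ∧ √3 < 1.73206 :=
  ⟨Real.lt_sqrt_of_sq_lt (by norm_num), (Real.sqrt_lt' (by norm_num)).2 (by norm_num)⟩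

theorem sqrt_six_bounds : 2.44948 < √6 ∧ √6 < 2.4495 :=
  ⟨Real.lt_sqrt_of_sq_lt (by norm_num), (Real.sqrt_lt' (by norm_num)).2 (by norm_num)⟩

theorem wStar_sq : wStar ^ 2 = 1 + 3 / 2 * epsStar := by
  have h2 : √2 ^ 2 = (2 : ℝ) := Real.sq_sqrt (by norm_num)
  have h3 : √3 ^ 2 = (3 : ℝ) := Real.sq_sqrt (by norm_num)
  rw [wStar, epsStar, sqrt_six_eq]
  linear_combination (1 / 4 + √3 ^ 2 / 4 - √3 / 2) * h2 + (3 / 2 - √2) * h3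

/-- The quartic is `9/4` times the height of the parabola above the curve at abscissa `(1 - 2w²)/3`.
-/
theorem quartic_factor (w : ℝ) :
    w ^ 4 - 10 * w ^ 2 + 12 * w - 2 =
      (w ^ 2 + 2 * √3 * w + (1 - √3)) * (w ^ 2 - 2 * √3 * w + (1 + √3)) := by
  have h3 : √3 ^ 2 = (3 : ℝ) := Real.sq_sqrt (by norm_num)
  linear_combination (4 * w ^ 2 + 1 - 4 * w) * h3

/-- The roots are `√3 ± √(2 - √3)`, and `√(2 - √3) = (√6 - √2)/2`; `wStar` is the smaller one. -/
theorem quadratic_factor (w : ℝ) :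
    w ^ 2 - 2 * √3 * w + (1 + √3) = (wStar - w) * (√3 + (√6 - √2) / 2 - w) := by
  have h2 : √2 ^ 2 = (2 : ℝ) := Real.sq_sqrt (by norm_num)
  have h3 : √3 ^ 2 = (3 : ℝ) := Real.sq_sqrt (by norm_num)
  rw [wStar, sqrt_six_eq]
  linear_combination (1 / 4 + √3 ^ 2 / 4 - √3 / 2) * h2 + (-1 / 2) * h3

theorem one_le_wStar : 1 ≤ wStar := by
  have := sqrt_two_bounds
  have := sqrt_three_bounds
  have := sqrt_six_bounds
  rw [wStar]
  linarith

theorem wStar_le : wStar ≤ 4 / 3 := by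
  have := sqrt_two_bounds
  have := sqrt_three_bounds
  have := sqrt_six_bounds
  rw [wStar]
  linarith

theorem curve_mem_coordRegion' {w : ℝ} (h0 : 1 ≤ w) (h1 : w ≤ 4 / 3) :
    ((1 - 2 * w ^ 2) / 3, 4 * w ^ 2 - 16 / 3 * w + 1) ∈ coordRegion := by
  convert curve_mem_coordRegion (c := 3 / 2 * w - 1) (by linarith) (by linarith) using 2 <;> ring

theorem quartic_nonneg {w : ℝ} (h0 : 1 ≤ w) (h1 : w ≤ wStar) :
    0 ≤ w ^ 4 - 10 * w ^ 2 + 12 * w - 2 := by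
  have := sqrt_two_bounds
  have := sqrt_three_bounds
  have := sqrt_six_bounds
  rw [quartic_factor, quadratic_factor]
  refine mul_nonneg (by nlinarith) (mul_nonneg (by linarith) ?_)
  have := wStar_le
  linarith

theorem quartic_wStar : wStar ^ 4 - 10 * wStar ^ 2 + 12 * wStar - 2 = 0 := by
  rw [quartic_factor, quadratic_factor, sub_self, zero_mul, mul_zero]

theorem parabola_mem_coordRegion {ε : ℝ} (h0 : -(4 / 3) ≤ ε) (h1 : ε ≤ epsStar) :
    (-1 / 3 - ε, (-1 / 3 - ε) ^ 2) ∈ coordRegion := by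
  rcases le_or_gt ε 0 with hε | hε
  · exact square_mem_coordRegion (by linarith) (by linarith)
  set x : ℝ := -1 / 3 - ε with hx
  set xs : ℝ := (1 - 2 * wStar ^ 2) / 3 with hxs
  set w := √(1 + 3 / 2 * ε) with hw
  have hw2 : w ^ 2 = 1 + 3 / 2 * ε := Real.sq_sqrt (by linarith)
  have hw1 : 1 ≤ w := Real.one_le_sqrt.2 (by linarith)
  have hws : w ≤ wStar := by
    refine le_of_sq_le_sq ?_ (by linarith [one_le_wStar])
    rw [hw2, wStar_sq]
    linarith
  have hxw : x = (1 - 2 * w ^ 2) / 3 := by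
    rw [hw2, hx]
    ring
  have hxsx : xs ≤ x := by
    rw [hxs, hx, wStar_sq]
    linarith
  have hx1 : x < 1 := by
    rw [hx]
    linarith
  have hlow : (x, 4 * w ^ 2 - 16 / 3 * w + 1) ∈ coordRegion := by
    rw [hxw]
    exact curve_mem_coordRegion' hw1 (hws.trans wStar_le)
  have hstar : (xs, xs ^ 2) ∈ coordRegion := by
    have h := curve_mem_coordRegion' one_le_wStar wStar_le
    have : 4 * wStar ^ 2 - 16 / 3 * wStar + 1 = xs ^ 2 := by
      rw [hxs]
      linear_combination (-4 / 9) * quartic_wStar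
    rwa [this] at h
  have hone : ((1 : ℝ), (1 : ℝ)) ∈ coordRegion := by
    simpa using square_mem_coordRegion (x := 1) (by norm_num) le_rfl
  have hd : 0 < 1 - xs := by linarith
  -- The point at abscissa `x` on the chord of the parabola from `xs` to `1`. Its height above the
  -- parabola is `(x - xs)(1 - x)`.
  have hup : (x, (1 + xs) * x - xs) ∈ coordRegion := by
    have h := convex_coordRegion hstar hone
      (div_nonneg (by linarith : 0 ≤ 1 - x) hd.le) (div_nonneg (by linarith : 0 ≤ x - xs) hd.le)
      (by
        rw [← add_div, div_eq_one_iff_eq hd.ne']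
        ring)
    convert h using 1
    ext <;> simp <;> field_simp <;> ring
  have hle1 : 4 * w ^ 2 - 16 / 3 * w + 1 ≤ x ^ 2 := by
    have := quartic_nonneg hw1 hws
    rw [hxw]
    nlinarith
  have hle2 : x ^ 2 ≤ (1 + xs) * x - xs := by nlinarith
  have hseg : x ^ 2 ∈ segment ℝ (4 * w ^ 2 - 16 / 3 * w + 1) ((1 + xs) * x - xs) := by
    rw [segment_eq_Icc (hle1.trans hle2)]
    exact ⟨hle1, hle2⟩
  obtain ⟨a, b, ha, hb, hab, hx2⟩ := hseg
  have h := convex_coordRegion hlow hup ha hb hab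
  convert h using 1
  ext
  · simp [← add_mul, hab]
  · simpa using hx2.symm

theorem abs_epsStar_sub_lt : |epsStar - 1 / √10| < 1 / 1000 := by
  have h2 := sqrt_two_bounds
  have h3 := sqrt_three_bounds
  have h6 := sqrt_six_bounds
  have h10 : 3.1622 < √10 ∧ √10 < 3.1623 :=
    ⟨Real.lt_sqrt_of_sq_lt (by norm_num), (Real.sqrt_lt' (by norm_num)).2 (by norm_num)⟩
  have hpos : (0 : ℝ) < √10 := by linarith [h10.1]
  have hlow : 0.3162 < 1 / √10 := by
    rw [lt_div_iff₀ hpos]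
    linarith [h10.2]
  have hup : 1 / √10 < 0.3163 := by
    rw [div_lt_iff₀ hpos]
    linarith [h10.1]
  rw [abs_lt, epsStar]
  constructor <;> linarith [h2.1, h2.2, h3.1, h3.2, h6.1, h6.2]

end Threshold

end TwoCopies

/-! ### Assembly of the statements -/

theorem mainTheorem6 :
    -- the family of unital channels and its parametrization
    (∀ ε ∈ Set.Icc (-(4 / 3) : ℝ) (2 / 3),
      TwoCopies.IsUnitalChannel (TwoCopies.channelT 3 (TwoCopies.deltaOf 3 ε)) ∧
      TwoCopies.jamiolkowski (TwoCopies.channelT 3 (TwoCopies.deltaOf 3 ε)) =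
        ((1 - 1 / 3 + ε / 2 : ℝ) : ℂ) • TwoCopies.rhoMinus 3 +
          ((1 / 3 - ε / 2 : ℝ) : ℂ) • TwoCopies.rhoPlus 3 ∧
      (TwoCopies.jamiolkowski (TwoCopies.channelT 3 (TwoCopies.deltaOf 3 ε)) *
        TwoCopies.flipOp (Fin 3)).trace = ((-1 + 2 / 3 - ε : ℝ) : ℂ)) ∧
    -- a single copy is not a mixture of unitary channels
    (∀ ε ∈ Set.Ioc (0 : ℝ) (2 / 3),
      ¬ TwoCopies.IsMixtureOfUnitaries (TwoCopies.channelT 3 (TwoCopies.deltaOf 3 ε))) ∧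
    -- the explicit unitary matrices and their coordinates
    (∀ θ ∈ Set.Icc (0 : ℝ) (Real.pi / 2),
      TwoCopies.matU θ ∈ Matrix.unitaryGroup (Fin 3 × Fin 3) ℂ ∧
      TwoCopies.coords (TwoCopies.conjBy (TwoCopies.matU θ)) =
        (((1 / 9 * (-(8 / 3) * (Real.cos θ + 1) ^ 2 + 3) : ℝ) : ℂ),
          ((1 / 9 * (16 * Real.cos θ ^ 2 - 7) : ℝ) : ℂ))) ∧
    -- the coordinates of two copies, and the threshold as the point where they meet the curve
    (∀ ε ∈ Set.Icc (-(4 / 3) : ℝ) (2 / 3),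
      TwoCopies.coords
          (TwoCopies.tensorMap (TwoCopies.channelT 3 (TwoCopies.deltaOf 3 ε))
            (TwoCopies.channelT 3 (TwoCopies.deltaOf 3 ε))) =
        (((-1 + 2 / 3 - ε : ℝ) : ℂ), (((-1 + 2 / 3 - ε) ^ 2 : ℝ) : ℂ))) ∧
    (∃ θ ∈ Set.Icc (0 : ℝ) (Real.pi / 2),
      TwoCopies.coords (TwoCopies.conjBy (TwoCopies.matU θ)) =
        TwoCopies.coords
          (TwoCopies.tensorMap (TwoCopies.channelT 3 (TwoCopies.deltaOf 3 TwoCopies.epsStar))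
            (TwoCopies.channelT 3 (TwoCopies.deltaOf 3 TwoCopies.epsStar)))) ∧
    -- two copies are a mixture of unitary channels up to the threshold
    (∀ ε ∈ Set.Icc (-(4 / 3) : ℝ) TwoCopies.epsStar,
      TwoCopies.IsMixtureOfUnitaries
        (TwoCopies.tensorMap (TwoCopies.channelT 3 (TwoCopies.deltaOf 3 ε))
          (TwoCopies.channelT 3 (TwoCopies.deltaOf 3 ε)))) ∧
    |TwoCopies.epsStar - 1 / √10| < 1 / 1000 := by
  have hδ : ∀ ε, TwoCopies.deltaOf 3 ε = 1 / 4 + 3 / 8 * ε := fun ε => by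
    rw [TwoCopies.deltaOf]
    push_cast
    ring
  have hval : ∀ ε : ℝ, ((1 - 8 * ((TwoCopies.deltaOf 3 ε : ℝ) : ℂ)) / 3) =
      ((-1 + 2 / 3 - ε : ℝ) : ℂ) := fun ε => by
    rw [hδ]
    push_cast
    ring
  have htwo : ∀ ε : ℝ, TwoCopies.coords
      (TwoCopies.tensorMap (TwoCopies.channelT 3 (TwoCopies.deltaOf 3 ε))
        (TwoCopies.channelT 3 (TwoCopies.deltaOf 3 ε))) =
      (((-1 + 2 / 3 - ε : ℝ) : ℂ), (((-1 + 2 / 3 - ε) ^ 2 : ℝ) : ℂ)) := fun ε => by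
    rw [TwoCopies.coords_tensorMap_channelT, hval, Complex.ofReal_pow]
  refine ⟨fun ε hε => ⟨?_, TwoCopies.jamiolkowski_channelT ε, ?_⟩, fun ε hε => ?_,
    fun θ _ => ⟨TwoCopies.matU_mem_unitaryGroup θ, TwoCopies.coords_conjBy_matU θ⟩,
    fun ε _ => htwo ε, ?_, fun ε hε => ?_, TwoCopies.abs_epsStar_sub_lt⟩
  · refine TwoCopies.isUnitalChannel_channelT ?_ ?_ <;> rw [hδ] <;> linarith [hε.1, hε.2]
  · rw [TwoCopies.trace_jamiolkowski_channelT_mul_flipOp, hval]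
  · refine TwoCopies.not_isMixtureOfUnitaries_channelT ?_
    rw [hδ]
    linarith [hε.1]
  · have h1 := TwoCopies.one_le_wStar
    have h2 := TwoCopies.wStar_le
    -- Inverts `w = (2/3)(cos θ + 1)` at the meeting point; the second coordinates then agree
    -- because `wStar` is a root of the quartic.
    obtain ⟨θ, hθ, hcos⟩ := TwoCopies.exists_angle (c := 3 / 2 * TwoCopies.wStar - 1)
      (by linarith) (by linarith)
    have hsq := TwoCopies.wStar_sq
    refine ⟨θ, hθ, ?_⟩
    rw [TwoCopies.coords_conjBy_matU, htwo, hcos]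
    congr 2
    · linear_combination (-2 / 3) * hsq
    · rw [show -1 + 2 / 3 - TwoCopies.epsStar = (1 - 2 * TwoCopies.wStar ^ 2) / 3 by linarith]
      linear_combination (-4 / 9) * TwoCopies.quartic_wStar
  · refine TwoCopies.isMixtureOfUnitaries_of_coords _ ?_
    obtain ⟨Z, hZ, hc⟩ := TwoCopies.parabola_mem_coordRegion hε.1 hε.2
    refine ⟨Z, hZ, ?_⟩
    rw [hc, htwo]
    norm_num
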